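/- **Theorem 4.8.** A Leibniz superalgebra of type $(p,m)$ is a complex $\mathbb{Z}_2$-graded vector space $L=L_0\oplus L_1$ with $\dim L_0=p$, $\dim L_1=m$, and a bilinear product satisfying $[L_\alpha,L_\beta]\subseteq L_{\alpha+\beta}$ and the graded Leibniz identity $$[x,[y,z]]=[[x,y],z]-(-1)^{\alpha\beta}[[x,z],y]\qquad (x\in L,\ y\in L_\alpha,\ z\in L_\beta).$$ It is nilpotent if $C^k(L)=0$ for some $k$, where $C^0(L)=L$ and $C^{k+1}(L)=[C^k(L),L]$. Let $N^{p,m}$ be the set of nilpotent Leibniz superalgebra laws on a fixed graded space $V=V_0\oplus V_1$ of type $(p,m)$, with the topology induced by the Zariski topology of the affine space of structure constants in a homogeneous basis. Let $O(\lambda)$ denote the orbit of a law $\lambda$ under $GL(V_0)\times GL(V_1)$, where $f=f_0+f_1$ sends $\lambda$ to the law $(x,y)\mapsto f^{-1}(\lambda(f(x),f(y)))$. Let $n\ge 2$, let $\{X_0,\dots,X_n\}$ be a basis of $V_0$ and $\{Y_1,Y_2\}$ a basis of $V_1$, and let $\mu_2,\mu_3$ be the laws of type $(n+1,2)$ given by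 $$\mu_2:\quad [X_i,X_0]=X_{i+1}\ (0\le i\le n-1),\quad [Y_1,X_0]=Y_2,\quad [Y_1,Y_1]=X_{n-1},\quad [Y_2,Y_1]=X_n;$$ $$\mu_3:\quad [X_i,X_0]=X_{i+1}\ (0\le i\le n-1),\quad [Y_1,X_0]=Y_2,\quad [X_0,Y_1]=-Y_2,\quad [Y_1,Y_1]=X_{n-1},\quad [Y_1,Y_2]=X_n;$$ all omitted products of basis vectors are zero. Then $O(\mu_2)$ and $O(\mu_3)$ are contained in $N^{n+1,2}$ and are Zariski open subsets of $N^{n+1,2}$ (that is, $\mu_2$ and $\mu_3$ are rigid), and the closures of these two orbits in $N^{n+1,2}$ are irreducible components of $N^{n+1,2}$. -/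

import Mathlib

namespace LeibnizSuper

/-- Indices of the structure constants of a graded product on a space of type `(n, m)` with
homogeneous basis `X_0, …, X_{n-1}` (even) and `Y_1, …, Y_m` (odd, indexed here by `0, …, m-1`):
the coefficient of the `k`-th basis vector in `[X_i, X_j]`, `[X_i, Y_j]`, `[Y_i, X_j]` and
`[Y_i, Y_j]` respectively. -/
inductive StructIndex (n m : ℕ) : Type
  | xx (i j k : Fin n)
  | xy (i : Fin n) (j k : Fin m)
  | yx (i : Fin m) (j : Fin n) (k : Fin m)
  | yy (i j : Fin m) (k : Fin n)

/-- The affine space of all products `[V_α, V_β] ⊆ V_{α+β}` on the graded space of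
type `(n, m)`, given by their structure constants. -/
def Law (n m : ℕ) : Type := StructIndex n m → ℂ

/-- A set of laws is algebraic if it is the common zero set of a set of polynomials in the
structure constants. -/
def IsAlgebraicSet {n m : ℕ} (Z : Set (Law n m)) : Prop :=
  ∃ S : Set (MvPolynomial (StructIndex n m) ℂ),
    Z = {l : Law n m | ∀ p ∈ S, MvPolynomial.eval (l : StructIndex n m → ℂ) p = 0}

/-- The Zariski topology on the affine space of laws: the closed sets are the algebraic sets. -/
instance zariskiTopology (n m : ℕ) : TopologicalSpace (Law n m) :=
  TopologicalSpace.ofClosed {Z : Set (Law n m) | IsAlgebraicSet Z}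
    ⟨{1}, by ext l; simp⟩
    (by
      intro A hA
      refine ⟨{p | ∃ Z ∈ A, ∀ l ∈ Z, MvPolynomial.eval (l : StructIndex n m → ℂ) p = 0}, ?_⟩
      ext l
      constructor
      · rintro hl p ⟨Z, hZ, hp⟩
        exact hp l (hl Z hZ)
      · intro hl Z hZ
        obtain ⟨S, rfl⟩ := hA hZ
        intro p hp
        exact hl p ⟨_, hZ, fun l' hl' => hl' p hp⟩)
    (by
      rintro _ ⟨S, rfl⟩ _ ⟨T, rfl⟩
      refine ⟨{r | ∃ p ∈ S, ∃ q ∈ T, r = p * q}, ?_⟩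
      ext l
      constructor
      · rintro (h | h) r ⟨p, hp, q, hq, rfl⟩
        · rw [map_mul, h p hp, zero_mul]
        · rw [map_mul, h q hq, mul_zero]
      · intro h
        by_contra hc
        rw [Set.mem_union, not_or] at hc
        obtain ⟨h1, h2⟩ := hc
        simp only [Set.mem_ofPred_eq, not_forall] at h1 h2
        obtain ⟨p, hp, hp0⟩ := h1
        obtain ⟨q, hq, hq0⟩ := h2
        have := h (p * q) ⟨p, hp, q, hq, rfl⟩
        rw [map_mul] at this
        exact (mul_ne_zero hp0 hq0) this)

/-- The underlying graded space `V = V_0 ⊕ V_1` with `dim V_0 = n`, `dim V_1 = m`. -/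
abbrev V (n m : ℕ) : Type := (Fin n → ℂ) × (Fin m → ℂ)

/-- The homogeneous components of `V`. -/
def homogeneous (n m : ℕ) (α : ZMod 2) : Submodule ℂ (V n m) :=
  if α = 0 then Submodule.prod ⊤ ⊥ else Submodule.prod ⊥ ⊤

theorem mem_homogeneous_zero {n m : ℕ} {x : V n m} : x ∈ homogeneous n m 0 ↔ x.2 = 0 := by
  simp [homogeneous]

theorem mem_homogeneous_one {n m : ℕ} {x : V n m} : x ∈ homogeneous n m 1 ↔ x.1 = 0 := by
  simp [homogeneous]

/-- The bilinear product on `V` with the given structure constants. -/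
def Law.bracket {n m : ℕ} (l : Law n m) : V n m →ₗ[ℂ] V n m →ₗ[ℂ] V n m :=
  LinearMap.mk₂ ℂ
    (fun x y =>
      (fun k => (∑ i, ∑ j, x.1 i * y.1 j * l (.xx i j k)) + ∑ i, ∑ j, x.2 i * y.2 j * l (.yy i j k),
       fun k => (∑ i, ∑ j, x.1 i * y.2 j * l (.xy i j k)) + ∑ i, ∑ j, x.2 i * y.1 j * l (.yx i j k)))
    (by
      intro x x' y
      ext k <;> simp [add_mul, Finset.sum_add_distrib] <;> ring)
    (by
      intro c x y
      ext k <;> simp [mul_add, Finset.mul_sum, mul_assoc])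
    (by
      intro x y y'
      ext k <;> simp [add_mul, mul_add, Finset.sum_add_distrib] <;> ring)
    (by
      intro c x y
      ext k <;> simp [mul_add, Finset.mul_sum, mul_assoc, mul_left_comm])

/-- The graded Leibniz identity. The product of a law is even by construction. -/
def Law.IsLeibniz {n m : ℕ} (l : Law n m) : Prop :=
  ∀ (α β : ZMod 2) (x y z : V n m), y ∈ homogeneous n m α → z ∈ homogeneous n m β →
    l.bracket x (l.bracket y z) =
      l.bracket (l.bracket x y) z - (-1 : ℂ) ^ (α.val * β.val) • l.bracket (l.bracket x z) y

/-- The descending central sequence `C^0(L) = L`, `C^{k+1}(L) = [C^k(L), L]`. -/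
def Law.centralSeries {n m : ℕ} (l : Law n m) : ℕ → Submodule ℂ (V n m)
  | 0 => ⊤
  | k + 1 => Submodule.map₂ l.bracket (l.centralSeries k) ⊤

/-- The law is nilpotent. -/
def Law.IsNilpotent {n m : ℕ} (l : Law n m) : Prop :=
  ∃ k : ℕ, l.centralSeries k = ⊥

/-- The variety of nilpotent Leibniz superalgebras of type `(n, m)`. -/
def nilpotentVariety (n m : ℕ) : Set (Law n m) :=
  {l | l.IsLeibniz ∧ l.IsNilpotent}

/-- The orbit of a law under `GL(V_0) × GL(V_1)`, which acts by change of basis. -/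
def Law.orbit {n m : ℕ} (l : Law n m) : Set (Law n m) :=
  {l' | ∃ (f₀ : (Fin n → ℂ) ≃ₗ[ℂ] (Fin n → ℂ)) (f₁ : (Fin m → ℂ) ≃ₗ[ℂ] (Fin m → ℂ)),
    ∀ x y : V n m,
      l'.bracket x y =
        (f₀.prodCongr f₁).symm (l.bracket ((f₀.prodCongr f₁) x) ((f₀.prodCongr f₁) y))}

/-- The orbit of a law as a subset of the variety of nilpotent Leibniz superalgebras, which
carries the topology induced by the Zariski topology. -/
def Law.orbitInVariety {n m : ℕ} (l : Law n m) : Set (nilpotentVariety n m) :=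
  Subtype.val ⁻¹' l.orbit

/-- The law `μ₂` of type `(n + 1, 2)`:
`[X_i, X_0] = X_{i+1}` for `0 ≤ i ≤ n - 1`, `[Y_1, X_0] = Y_2`, `[Y_1, Y_1] = X_{n-1}`,
`[Y_2, Y_1] = X_n`, all other products of basis vectors being zero. -/
def mu2 (n : ℕ) : Law (n + 1) 2
  | .xx i j k => if j = 0 ∧ (k : ℕ) = i + 1 then 1 else 0
  | .xy _ _ _ => 0
  | .yx i j k => if i = 0 ∧ j = 0 ∧ k = 1 then 1 else 0
  | .yy i j k =>
      if (i = 0 ∧ j = 0 ∧ (k : ℕ) + 1 = n) ∨ (i = 1 ∧ j = 0 ∧ (k : ℕ) = n) then 1 else 0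

/-- The law `μ₃` of type `(n + 1, 2)`:
`[X_i, X_0] = X_{i+1}` for `0 ≤ i ≤ n - 1`, `[Y_1, X_0] = Y_2`, `[X_0, Y_1] = -Y_2`,
`[Y_1, Y_1] = X_{n-1}`, `[Y_1, Y_2] = X_n`, all other products of basis vectors being zero. -/
def mu3 (n : ℕ) : Law (n + 1) 2
  | .xx i j k => if j = 0 ∧ (k : ℕ) = i + 1 then 1 else 0
  | .xy i j k => if i = 0 ∧ j = 0 ∧ k = 1 then -1 else 0
  | .yx i j k => if i = 0 ∧ j = 0 ∧ k = 1 then 1 else 0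
  | .yy i j k =>
      if (i = 0 ∧ j = 0 ∧ (k : ℕ) + 1 = n) ∨ (i = 0 ∧ j = 1 ∧ (k : ℕ) = n) then 1 else 0

end LeibnizSuper

/-! Write `R_a` for right multiplication `z ↦ [z, a]`. Inside the nilpotent variety each orbit is
characterized by the non-vanishing of two polynomial expressions at some even `x` and odd `y`:
`R_x^n x ≠ 0` in both cases, together with `[[y,x],y] ≠ 0` for `μ₂` and `[y,[y,x]] ≠ 0` for `μ₃`.
Such conditions define an open set, so rigidity reduces to showing that they determine the law up to
change of basis.

Let them hold. As `R_x` is nilpotent, `x, R_x x, …, R_x^n x` is a basis of `V₀`, while `y, [y,x]` is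
a basis of `V₁` and `[[y,x],x] = 0`. The Leibniz identity then leaves little freedom
(`Law.IsLeibniz.exists_productTable`): `[x,y] = b[y,x]`, with `(b+1) R_{[y,x]} = 0` and `b [[y,x],y]
= 0`. So `[[y,x],y] ≠ 0` forces `b = 0` and `R_{[y,x]} = 0`, whereas `[y,[y,x]] ≠ 0` forces `b = -1`
and `[[y,x],y] = 0`. In both cases `[y,y]` lies in the span of the last two even basis vectors, with
non-zero coefficient on the first of them, and replacing `y` by some `βy + γ[y,x]` makes it equal to
`X_{n-1}`. The products are now those of the model (`mem_orbit_mu2`, `mem_orbit_mu3`).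

For the components, an orbit is irreducible because `GL(V₀) × GL(V₁)` is: two of its points lie on a
rational curve inside the orbit, obtained from a line of matrices (`Law.isIrreducible_orbit`). A
non-empty irreducible open set is dense in every irreducible set containing it, so its closure is a
component. -/

namespace LeibnizSuper

open Matrix

/-! ### Structure constants, bilinear products and the orbit in matrix form. -/

section Bracket

variable {n m : ℕ}

theorem Law.bracket_apply (l : Law n m) (x y : V n m) :
    l.bracket x y =
      (fun k => (∑ i, ∑ j, x.1 i * y.1 j * l (.xx i j k)) + ∑ i, ∑ j, x.2 i * y.2 j * l (.yy i j k),
       fun k => (∑ i, ∑ j, x.1 i * y.2 j * l (.xy i j k)) +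
         ∑ i, ∑ j, x.2 i * y.1 j * l (.yx i j k)) :=
  rfl

theorem Law.bracket_even_even (l : Law n m) (i j : Fin n) :
    l.bracket (Pi.single i 1, 0) (Pi.single j 1, 0) = (fun k => l (.xx i j k), 0) := by
  ext k <;> simp [Law.bracket_apply, Pi.single_apply]

theorem Law.bracket_even_odd (l : Law n m) (i : Fin n) (j : Fin m) :
    l.bracket (Pi.single i 1, 0) (0, Pi.single j 1) = (0, fun k => l (.xy i j k)) := by
  ext k <;> simp [Law.bracket_apply, Pi.single_apply]

theorem Law.bracket_odd_even (l : Law n m) (i : Fin m) (j : Fin n) :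
    l.bracket (0, Pi.single i 1) (Pi.single j 1, 0) = (0, fun k => l (.yx i j k)) := by
  ext k <;> simp [Law.bracket_apply, Pi.single_apply]

theorem Law.bracket_odd_odd (l : Law n m) (i j : Fin m) :
    l.bracket (0, Pi.single i 1) (0, Pi.single j 1) = (fun k => l (.yy i j k), 0) := by
  ext k <;> simp [Law.bracket_apply, Pi.single_apply]

theorem bilinear_ext {B C : V n m →ₗ[ℂ] V n m →ₗ[ℂ] V n m}
    (h₀₀ : ∀ i j, B (Pi.single i 1, 0) (Pi.single j 1, 0) = C (Pi.single i 1, 0) (Pi.single j 1, 0))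
    (h₀₁ : ∀ i j, B (Pi.single i 1, 0) (0, Pi.single j 1) = C (Pi.single i 1, 0) (0, Pi.single j 1))
    (h₁₀ : ∀ i j, B (0, Pi.single i 1) (Pi.single j 1, 0) = C (0, Pi.single i 1) (Pi.single j 1, 0))
    (h₁₁ : ∀ i j, B (0, Pi.single i 1) (0, Pi.single j 1) = C (0, Pi.single i 1) (0, Pi.single j 1)) :
    B = C := by
  refine LinearMap.prod_ext ?_ ?_ <;> refine LinearMap.pi_ext' fun i => ?_ <;>
    refine LinearMap.ext_ring ?_ <;>
    refine LinearMap.prod_ext ?_ ?_ <;> refine LinearMap.pi_ext' fun j => ?_ <;>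
    refine LinearMap.ext_ring ?_
  · exact h₀₀ i j
  · exact h₀₁ i j
  · exact h₁₀ i j
  · exact h₁₁ i j

/-- The law whose structure constants are those of `(x, y) ↦ h (l (f x, f y))`, where the even
maps `f` and `h` are given by their matrices. -/
noncomputable def Law.transport (l : Law n m) (A₀ B₀ : Matrix (Fin n) (Fin n) ℂ)
    (A₁ B₁ : Matrix (Fin m) (Fin m) ℂ) : Law n m
  | .xx i j k => (B₀ *ᵥ (l.bracket (A₀.col i, 0) (A₀.col j, 0)).1) k
  | .xy i j k => (B₁ *ᵥ (l.bracket (A₀.col i, 0) (0, A₁.col j)).2) k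
  | .yx i j k => (B₁ *ᵥ (l.bracket (0, A₁.col i) (A₀.col j, 0)).2) k
  | .yy i j k => (B₀ *ᵥ (l.bracket (0, A₁.col i) (0, A₁.col j)).1) k

theorem Law.transport_bracket (l : Law n m) (A₀ B₀ : Matrix (Fin n) (Fin n) ℂ)
    (A₁ B₁ : Matrix (Fin m) (Fin m) ℂ) (x y : V n m) :
    (l.transport A₀ B₀ A₁ B₁).bracket x y =
      (B₀.toLin'.prodMap B₁.toLin')
        (l.bracket (A₀.toLin'.prodMap A₁.toLin' x) (A₀.toLin'.prodMap A₁.toLin' y)) := by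
  have h : (l.transport A₀ B₀ A₁ B₁).bracket =
      (l.bracket.compl₁₂ (A₀.toLin'.prodMap A₁.toLin') (A₀.toLin'.prodMap A₁.toLin')).compr₂
        (B₀.toLin'.prodMap B₁.toLin') := by
    refine bilinear_ext (fun i j => ?_) (fun i j => ?_) (fun i j => ?_) (fun i j => ?_)
    · rw [Law.bracket_even_even]
      ext k <;> simp [Law.transport]
      simp [Law.bracket_apply, Matrix.mulVec, dotProduct]
    · rw [Law.bracket_even_odd]
      ext k <;> simp [Law.transport]
      simp [Law.bracket_apply, Matrix.mulVec, dotProduct]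
    · rw [Law.bracket_odd_even]
      ext k <;> simp [Law.transport]
      simp [Law.bracket_apply, Matrix.mulVec, dotProduct]
    · rw [Law.bracket_odd_odd]
      ext k <;> simp [Law.transport]
      simp [Law.bracket_apply, Matrix.mulVec, dotProduct]
  rw [h]
  rfl

theorem Law.ext_bracket {l l' : Law n m} (h : l.bracket = l'.bracket) : l = l' := by
  funext s
  cases s with
  | xx i j k =>
    have := congrArg (fun B => (B (Pi.single i 1, 0) (Pi.single j 1, 0)).1 k) h
    simpa only [Law.bracket_even_even] using this
  | xy i j k =>
    have := congrArg (fun B => (B (Pi.single i 1, 0) (0, Pi.single j 1)).2 k) h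
    simpa only [Law.bracket_even_odd] using this
  | yx i j k =>
    have := congrArg (fun B => (B (0, Pi.single i 1) (Pi.single j 1, 0)).2 k) h
    simpa only [Law.bracket_odd_even] using this
  | yy i j k =>
    have := congrArg (fun B => (B (0, Pi.single i 1) (0, Pi.single j 1)).1 k) h
    simpa only [Law.bracket_odd_odd] using this

theorem Law.mem_orbit_iff_transport {l l' : Law n m} :
    l' ∈ l.orbit ↔ ∃ (A₀ : Matrix (Fin n) (Fin n) ℂ) (A₁ : Matrix (Fin m) (Fin m) ℂ),
      A₀.det ≠ 0 ∧ A₁.det ≠ 0 ∧ l' = l.transport A₀ A₀⁻¹ A₁ A₁⁻¹ := by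
  constructor
  · rintro ⟨f₀, f₁, h⟩
    have key : ∀ {d : ℕ} (f : (Fin d → ℂ) ≃ₗ[ℂ] (Fin d → ℂ)),
        IsUnit (LinearMap.toMatrix' (f : (Fin d → ℂ) →ₗ[ℂ] (Fin d → ℂ))).det ∧
        (LinearMap.toMatrix' (f : (Fin d → ℂ) →ₗ[ℂ] (Fin d → ℂ)))⁻¹ =
          LinearMap.toMatrix' (f.symm : (Fin d → ℂ) →ₗ[ℂ] (Fin d → ℂ)) := by
      intro d f
      have h1 : LinearMap.toMatrix' (f : (Fin d → ℂ) →ₗ[ℂ] (Fin d → ℂ)) *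
          LinearMap.toMatrix' (f.symm : (Fin d → ℂ) →ₗ[ℂ] (Fin d → ℂ)) = 1 := by
        rw [← LinearMap.toMatrix'_comp]
        simp
      exact ⟨Matrix.isUnit_det_of_right_inverse h1, Matrix.inv_eq_right_inv h1⟩
    refine ⟨LinearMap.toMatrix' (f₀ : (Fin n → ℂ) →ₗ[ℂ] (Fin n → ℂ)),
      LinearMap.toMatrix' (f₁ : (Fin m → ℂ) →ₗ[ℂ] (Fin m → ℂ)), (key f₀).1.ne_zero,
      (key f₁).1.ne_zero, Law.ext_bracket (LinearMap.ext₂ fun x y => ?_)⟩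
    rw [h, Law.transport_bracket, (key f₀).2, (key f₁).2]
    simp only [Matrix.toLin'_toMatrix']
    rfl
  · rintro ⟨A₀, A₁, h₀, h₁, rfl⟩
    refine ⟨Matrix.toLin'OfInv (Matrix.nonsing_inv_mul A₀ (isUnit_iff_ne_zero.2 h₀))
      (Matrix.mul_nonsing_inv A₀ (isUnit_iff_ne_zero.2 h₀)),
      Matrix.toLin'OfInv (Matrix.nonsing_inv_mul A₁ (isUnit_iff_ne_zero.2 h₁))
      (Matrix.mul_nonsing_inv A₁ (isUnit_iff_ne_zero.2 h₁)), fun x y => ?_⟩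
    rw [Law.transport_bracket]
    rfl

end Bracket

/-! ### Polynomial dependence on the structure constants, and Zariski open sets. -/

section Regular

variable {T : Type*} {n m : ℕ}

/-- A family of vectors of `V` whose coordinates belong to the algebra `A` of functions. -/
def IsRegular (A : Subalgebra ℂ (T → ℂ)) (F : T → V n m) : Prop :=
  (∀ k, (fun t => (F t).1 k) ∈ A) ∧ ∀ k, (fun t => (F t).2 k) ∈ A

theorem IsRegular.const (A : Subalgebra ℂ (T → ℂ)) (v : V n m) : IsRegular A fun _ => v :=
  ⟨fun k => A.algebraMap_mem (v.1 k), fun k => A.algebraMap_mem (v.2 k)⟩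

theorem sum_sum_mul_mem {ι κ : Type*} [Fintype ι] [Fintype κ] (A : Subalgebra ℂ (T → ℂ))
    {f : ι → T → ℂ} {g : κ → T → ℂ} {c : ι → κ → T → ℂ} (hf : ∀ i, f i ∈ A) (hg : ∀ j, g j ∈ A)
    (hc : ∀ i j, c i j ∈ A) : (fun t => ∑ i, ∑ j, f i t * g j t * c i j t) ∈ A := by
  have : (fun t => ∑ i, ∑ j, f i t * g j t * c i j t) = ∑ i, ∑ j, f i * g j * c i j := by
    ext t
    simp
  rw [this]
  exact sum_mem fun i _ => sum_mem fun j _ => mul_mem (mul_mem (hf i) (hg j)) (hc i j)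

theorem IsRegular.bracket {A : Subalgebra ℂ (T → ℂ)} {l : T → Law n m} {F G : T → V n m}
    (hl : ∀ s, (fun t => l t s) ∈ A) (hF : IsRegular A F) (hG : IsRegular A G) :
    IsRegular A fun t => (l t).bracket (F t) (G t) :=
  ⟨fun k => add_mem (sum_sum_mul_mem A hF.1 hG.1 fun i j => hl (.xx i j k))
      (sum_sum_mul_mem A hF.2 hG.2 fun i j => hl (.yy i j k)),
    fun k => add_mem (sum_sum_mul_mem A hF.1 hG.2 fun i j => hl (.xy i j k))
      (sum_sum_mul_mem A hF.2 hG.1 fun i j => hl (.yx i j k))⟩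

/-- The polynomial functions of the structure constants. -/
noncomputable def polynomialFunctions (n m : ℕ) : Subalgebra ℂ (Law n m → ℂ) :=
  (MvPolynomial.aeval fun (s : StructIndex n m) (l : Law n m) => l s).range

theorem aeval_apply_eq_eval {σ : Type*} (c : σ → T → ℂ) (p : MvPolynomial σ ℂ) (t : T) :
    MvPolynomial.aeval c p t = MvPolynomial.eval (fun s => c s t) p := by
  induction p using MvPolynomial.induction_on with
  | C a => simp
  | add p q hp hq => simp [hp, hq]
  | mul_X p i hp => simp [hp]

theorem mem_polynomialFunctions {f : Law n m → ℂ} :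
    f ∈ polynomialFunctions n m ↔
      ∃ p : MvPolynomial (StructIndex n m) ℂ, ∀ l : Law n m,
        f l = MvPolynomial.eval (l : StructIndex n m → ℂ) p := by
  have key := aeval_apply_eq_eval fun (s : StructIndex n m) (l : Law n m) => l s
  constructor
  · rintro ⟨p, rfl⟩
    exact ⟨p, key p⟩
  · rintro ⟨p, hp⟩
    exact ⟨p, funext fun l => (key p l).trans (hp l).symm⟩

theorem coord_mem_polynomialFunctions (s : StructIndex n m) :
    (fun l : Law n m => l s) ∈ polynomialFunctions n m :=
  mem_polynomialFunctions.2 ⟨MvPolynomial.X s, fun l => (MvPolynomial.eval_X (f := l) s).symm⟩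

theorem isClosed_iff_isAlgebraicSet {Z : Set (Law n m)} : IsClosed Z ↔ IsAlgebraicSet Z := by
  rw [← isOpen_compl_iff]
  change IsAlgebraicSet Zᶜᶜ ↔ _
  rw [compl_compl]

theorem isOpen_ne_zero {f : Law n m → ℂ} (hf : f ∈ polynomialFunctions n m) :
    IsOpen {l | f l ≠ 0} := by
  obtain ⟨p, hp⟩ := mem_polynomialFunctions.1 hf
  rw [← isClosed_compl_iff, isClosed_iff_isAlgebraicSet]
  exact ⟨{p}, by ext l; simp [hp]⟩

theorem IsRegular.isOpen_ne_zero {F : Law n m → V n m}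
    (hF : IsRegular (polynomialFunctions n m) F) : IsOpen {l | F l ≠ 0} := by
  have : {l | F l ≠ 0} = (⋃ k, {l | (F l).1 k ≠ 0}) ∪ ⋃ k, {l | (F l).2 k ≠ 0} := by
    ext l
    simp only [Set.mem_union, Set.mem_iUnion, Set.mem_ofPred_eq, ne_eq, Prod.ext_iff, funext_iff,
      not_and_or, not_forall, Prod.fst_zero, Prod.snd_zero, Pi.zero_apply]
  rw [this]
  exact (isOpen_iUnion fun k => LeibnizSuper.isOpen_ne_zero (hF.1 k)).union
    (isOpen_iUnion fun k => LeibnizSuper.isOpen_ne_zero (hF.2 k))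

/-- The non-vanishing sets of single polynomials form a base of the Zariski topology. -/
theorem exists_polynomial_ne_zero_of_isOpen {U : Set (Law n m)} (hU : IsOpen U) {l : Law n m}
    (hl : l ∈ U) : ∃ p : MvPolynomial (StructIndex n m) ℂ,
      MvPolynomial.eval (l : StructIndex n m → ℂ) p ≠ 0 ∧
      ∀ l' : Law n m, MvPolynomial.eval (l' : StructIndex n m → ℂ) p ≠ 0 → l' ∈ U := by
  obtain ⟨S, hS⟩ := isClosed_iff_isAlgebraicSet.1 hU.isClosed_compl
  have h : l ∉ Uᶜ := fun h => h hl
  rw [hS] at h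
  simp only [Set.mem_ofPred_eq, not_forall] at h
  obtain ⟨p, hp, hp0⟩ := h
  refine ⟨p, hp0, fun l' hl' => ?_⟩
  by_contra hc
  have : l' ∈ Uᶜ := hc
  rw [hS] at this
  exact hl' (this p hp)

end Regular

/-! ### Irreducibility of orbits, and components from open irreducible sets. -/

section Irreducible

variable {n m : ℕ}

/-- Polynomial functions of one complex variable. -/
noncomputable def univariateFunctions : Subalgebra ℂ (ℂ → ℂ) :=
  (Polynomial.aeval (id : ℂ → ℂ)).range

theorem mem_univariateFunctions {f : ℂ → ℂ} :
    f ∈ univariateFunctions ↔ ∃ p : Polynomial ℂ, ∀ t, f t = p.eval t := by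
  have key : ∀ (p : Polynomial ℂ) (t : ℂ), Polynomial.aeval (id : ℂ → ℂ) p t = p.eval t := by
    intro p t
    induction p using Polynomial.induction_on' with
    | add p q hp hq => simp_all
    | monomial k a => simp [Polynomial.aeval_monomial]
  constructor
  · rintro ⟨p, rfl⟩
    exact ⟨p, key p⟩
  · rintro ⟨p, hp⟩
    exact ⟨p, funext fun t => (key p t).trans (hp t).symm⟩

/-- A polynomial evaluated along a rational curve is a polynomial up to a power of the
denominator. -/
theorem exists_clear_denominator {σ : Type*} {F G : ℂ → σ → ℂ} {Q : ℂ → ℂ}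
    (hQ : Q ∈ univariateFunctions) (hG : ∀ s, (fun t => G t s) ∈ univariateFunctions)
    (hF : ∀ t s, Q t ≠ 0 → F t s = (Q t)⁻¹ * G t s) (p : MvPolynomial σ ℂ) :
    ∃ (N : ℕ) (R : ℂ → ℂ), R ∈ univariateFunctions ∧
      ∀ t, Q t ≠ 0 → MvPolynomial.eval (F t) p * Q t ^ N = R t := by
  induction p using MvPolynomial.induction_on with
  | C a => exact ⟨0, fun _ => a, univariateFunctions.algebraMap_mem a, fun t _ => by simp⟩
  | add p q hp hq =>
    obtain ⟨N, R, hR, h⟩ := hp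
    obtain ⟨N', R', hR', h'⟩ := hq
    refine ⟨N + N', R * Q ^ N' + R' * Q ^ N,
      add_mem (mul_mem hR (pow_mem hQ _)) (mul_mem hR' (pow_mem hQ _)), fun t ht => ?_⟩
    simp only [map_add, Pi.add_apply, Pi.mul_apply, Pi.pow_apply, ← h t ht, ← h' t ht]
    ring
  | mul_X p s hp =>
    obtain ⟨N, R, hR, h⟩ := hp
    refine ⟨N + 1, R * fun t => G t s, mul_mem hR (hG s), fun t ht => ?_⟩
    simp only [map_mul, MvPolynomial.eval_X, Pi.mul_apply, ← h t ht, hF t s ht]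
    field_simp
    ring

theorem det_mem_univariateFunctions {d : ℕ} {M : ℂ → Matrix (Fin d) (Fin d) ℂ}
    (hM : ∀ i j, (fun t => M t i j) ∈ univariateFunctions) :
    (fun t => (M t).det) ∈ univariateFunctions := by
  have : (fun t => (M t).det) =
      ∑ σ : Equiv.Perm (Fin d), (((Equiv.Perm.sign σ : ℤ) : ℂ)) • ∏ i, fun t => M t (σ i) i := by
    ext t
    simp [Matrix.det_apply']
  rw [this]
  exact sum_mem fun σ _ => Subalgebra.smul_mem _ (prod_mem fun i _ => hM (σ i) i) _

theorem adjugate_mem_univariateFunctions {d : ℕ} {M : ℂ → Matrix (Fin d) (Fin d) ℂ}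
    (hM : ∀ i j, (fun t => M t i j) ∈ univariateFunctions) (i j : Fin d) :
    (fun t => (M t).adjugate i j) ∈ univariateFunctions := by
  simp only [Matrix.adjugate_apply]
  refine det_mem_univariateFunctions fun a b => ?_
  by_cases h : a = j
  · subst h
    simp only [Matrix.updateRow_self]
    exact univariateFunctions.algebraMap_mem (Pi.single (M := fun _ : Fin d => ℂ) i 1 b)
  · simpa [Matrix.updateRow_ne h] using hM a b

theorem mulVec_mem_univariateFunctions {d : ℕ} {M : ℂ → Matrix (Fin d) (Fin d) ℂ}
    {v : ℂ → Fin d → ℂ} (hM : ∀ i j, (fun t => M t i j) ∈ univariateFunctions)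
    (hv : ∀ j, (fun t => v t j) ∈ univariateFunctions) (i : Fin d) :
    (fun t => (M t *ᵥ v t) i) ∈ univariateFunctions := by
  have : (fun t => (M t *ᵥ v t) i) = ∑ j, (fun t => M t i j) * fun t => v t j := by
    ext t
    simp [Matrix.mulVec, dotProduct]
  rw [this]
  exact sum_mem fun j _ => mul_mem (hM i j) (hv j)

theorem Law.transport_mem_univariateFunctions (l : Law n m)
    {A₀ B₀ : ℂ → Matrix (Fin n) (Fin n) ℂ} {A₁ B₁ : ℂ → Matrix (Fin m) (Fin m) ℂ}
    (hA₀ : ∀ i j, (fun t => A₀ t i j) ∈ univariateFunctions)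
    (hB₀ : ∀ i j, (fun t => B₀ t i j) ∈ univariateFunctions)
    (hA₁ : ∀ i j, (fun t => A₁ t i j) ∈ univariateFunctions)
    (hB₁ : ∀ i j, (fun t => B₁ t i j) ∈ univariateFunctions) (s : StructIndex n m) :
    (fun t => l.transport (A₀ t) (B₀ t) (A₁ t) (B₁ t) s) ∈ univariateFunctions := by
  have hl : ∀ s, (fun _ : ℂ => l s) ∈ univariateFunctions :=
    fun s => univariateFunctions.algebraMap_mem (l s)
  have h0 : (fun _ : ℂ => (0 : ℂ)) ∈ univariateFunctions := univariateFunctions.zero_mem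
  have hx : ∀ i, IsRegular univariateFunctions fun t => (((A₀ t).col i, 0) : V n m) :=
    fun i => ⟨fun k => hA₀ k i, fun _ => h0⟩
  have hy : ∀ i, IsRegular univariateFunctions fun t => ((0, (A₁ t).col i) : V n m) :=
    fun i => ⟨fun _ => h0, fun k => hA₁ k i⟩
  cases s with
  | xx i j k => exact mulVec_mem_univariateFunctions hB₀ (IsRegular.bracket hl (hx i) (hx j)).1 k
  | xy i j k => exact mulVec_mem_univariateFunctions hB₁ (IsRegular.bracket hl (hx i) (hy j)).2 k
  | yx i j k => exact mulVec_mem_univariateFunctions hB₁ (IsRegular.bracket hl (hy i) (hx j)).2 k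
  | yy i j k => exact mulVec_mem_univariateFunctions hB₀ (IsRegular.bracket hl (hy i) (hy j)).1 k

/-- Allows inverse matrices to be traded for adjugates, at the price of one scalar factor common to
all structure constants. -/
theorem Law.transport_smul (l : Law n m) (A₀ B₀ : Matrix (Fin n) (Fin n) ℂ)
    (A₁ B₁ : Matrix (Fin m) (Fin m) ℂ) (c : ℂ) (s : StructIndex n m) :
    l.transport A₀ (c • B₀) A₁ (c • B₁) s = c * l.transport A₀ B₀ A₁ B₁ s := by
  cases s <;> simp [Law.transport, Matrix.smul_mulVec]

/-- Two points of the orbit come from pairs of invertible matrices. Along the segments joining these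
pairs, the law is a rational function of the parameter `t`, and two non-empty open conditions on a
line are met simultaneously. -/
theorem Law.isIrreducible_orbit (l : Law n m) : IsIrreducible l.orbit := by
  refine ⟨⟨l, LinearEquiv.refl _ _, LinearEquiv.refl _ _, fun x y => rfl⟩, ?_⟩
  rintro U W hU hW ⟨l₁, hl₁, hl₁U⟩ ⟨l₂, hl₂, hl₂W⟩
  obtain ⟨p, hp, hpU⟩ := exists_polynomial_ne_zero_of_isOpen hU hl₁U
  obtain ⟨q, hq, hqW⟩ := exists_polynomial_ne_zero_of_isOpen hW hl₂W
  obtain ⟨A₀, A₁, hA₀, hA₁, rfl⟩ := Law.mem_orbit_iff_transport.1 hl₁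
  obtain ⟨B₀, B₁, hB₀, hB₁, rfl⟩ := Law.mem_orbit_iff_transport.1 hl₂
  have hline : ∀ {d : ℕ} (A B : Matrix (Fin d) (Fin d) ℂ) (i j : Fin d),
      (fun t : ℂ => (A + t • (B - A)) i j) ∈ univariateFunctions := fun A B i j =>
    mem_univariateFunctions.2 ⟨.C (A i j) + .X * .C (B i j - A i j), fun t => by simp⟩
  set M₀ : ℂ → Matrix (Fin n) (Fin n) ℂ := fun t => A₀ + t • (B₀ - A₀) with hM₀
  set M₁ : ℂ → Matrix (Fin m) (Fin m) ℂ := fun t => A₁ + t • (B₁ - A₁) with hM₁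
  set F : ℂ → Law n m := fun t => l.transport (M₀ t) (M₀ t)⁻¹ (M₁ t) (M₁ t)⁻¹ with hF
  set Q : ℂ → ℂ := fun t => (M₀ t).det * (M₁ t).det with hQ
  have hQm : Q ∈ univariateFunctions :=
    mul_mem (det_mem_univariateFunctions (hline A₀ B₀)) (det_mem_univariateFunctions (hline A₁ B₁))
  have hsm : ∀ {d : ℕ} {c : ℂ → ℂ} {M : ℂ → Matrix (Fin d) (Fin d) ℂ}, c ∈ univariateFunctions →
      (∀ i j, (fun t => M t i j) ∈ univariateFunctions) →
      ∀ i j, (fun t => (c t • M t) i j) ∈ univariateFunctions :=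
    fun hc hM i j => mul_mem hc (hM i j)
  -- Each adjugate is multiplied by the determinant of the other matrix, so that both inverses have
  -- the common denominator `Q` and `Q t • F t` is polynomial in `t`.
  have hG := l.transport_mem_univariateFunctions (hline A₀ B₀)
    (hsm (det_mem_univariateFunctions (hline A₁ B₁)) (adjugate_mem_univariateFunctions (hline A₀ B₀)))
    (hline A₁ B₁)
    (hsm (det_mem_univariateFunctions (hline A₀ B₀)) (adjugate_mem_univariateFunctions (hline A₁ B₁)))
  have hinv : ∀ t s, Q t ≠ 0 → F t s = (Q t)⁻¹ * l.transport (M₀ t) ((M₁ t).det • (M₀ t).adjugate)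
      (M₁ t) ((M₀ t).det • (M₁ t).adjugate) s := by
    intro t s ht
    have h0 : (M₀ t).det ≠ 0 := left_ne_zero_of_mul ht
    have h1 : (M₁ t).det ≠ 0 := right_ne_zero_of_mul ht
    rw [← Law.transport_smul]
    simp only [hF, hQ, Matrix.inv_def, smul_smul, Ring.inverse_eq_inv']
    congr 2 <;> field_simp
  have hF0 : F 0 = l.transport A₀ A₀⁻¹ A₁ A₁⁻¹ := by simp [hF, hM₀, hM₁]
  have hF1 : F 1 = l.transport B₀ B₀⁻¹ B₁ B₁⁻¹ := by simp [hF, hM₀, hM₁]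
  have hQ0 : Q 0 ≠ 0 := by simp [hQ, hM₀, hM₁, hA₀, hA₁]
  have hQ1 : Q 1 ≠ 0 := by simp [hQ, hM₀, hM₁, hB₀, hB₁]
  obtain ⟨N, R, hR, hpR⟩ := exists_clear_denominator (F := F) hQm hG hinv p
  obtain ⟨N', R', hR', hqR⟩ := exists_clear_denominator (F := F) hQm hG hinv q
  obtain ⟨P, hP⟩ := mem_univariateFunctions.1 hR
  obtain ⟨P', hP'⟩ := mem_univariateFunctions.1 hR'
  obtain ⟨P'', hP''⟩ := mem_univariateFunctions.1 hQm
  -- `P` is non-zero at `0`, `P'` at `1`, and `P''` at `0`. A parameter where the product does not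
  -- vanish gives an invertible pair whose law lies in both open sets.
  have hne : P * P' * P'' ≠ 0 := by
    refine mul_ne_zero (mul_ne_zero ?_ ?_) ?_
    · rintro rfl
      have := hpR 0 hQ0
      rw [hP, Polynomial.eval_zero, hF0] at this
      exact mul_ne_zero hp (pow_ne_zero _ hQ0) this
    · rintro rfl
      have := hqR 1 hQ1
      rw [hP', Polynomial.eval_zero, hF1] at this
      exact mul_ne_zero hq (pow_ne_zero _ hQ1) this
    · rintro rfl
      exact hQ0 (by rw [hP'', Polynomial.eval_zero])
  obtain ⟨t, ht⟩ : ∃ t, (P * P' * P'').eval t ≠ 0 := by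
    by_contra! h
    exact hne (Polynomial.funext fun t => by simpa using h t)
  rw [Polynomial.eval_mul, Polynomial.eval_mul, ← hP, ← hP', ← hP''] at ht
  have htQ : Q t ≠ 0 := right_ne_zero_of_mul ht
  rw [← hpR t htQ, ← hqR t htQ] at ht
  refine ⟨F t, Law.mem_orbit_iff_transport.2
    ⟨M₀ t, M₁ t, left_ne_zero_of_mul htQ, right_ne_zero_of_mul htQ, rfl⟩, hpU _ ?_, hqW _ ?_⟩
  · exact left_ne_zero_of_mul (left_ne_zero_of_mul (left_ne_zero_of_mul ht))
  · exact left_ne_zero_of_mul (right_ne_zero_of_mul (left_ne_zero_of_mul ht))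

/-- In an irreducible `Z` containing `U`, any open set meeting `Z` also meets `U`; hence `Z` lies in
the closure of `U`. -/
theorem _root_.IsOpen.closure_mem_irreducibleComponents {X : Type*} [TopologicalSpace X]
    {U : Set X} (hU : IsOpen U) (h : IsIrreducible U) : closure U ∈ irreducibleComponents X := by
  refine ⟨h.closure, fun Z hZ hUZ => ?_⟩
  have hU' : U ⊆ Z := subset_closure.trans hUZ
  obtain ⟨x, hx⟩ := h.nonempty
  intro z hz
  rw [mem_closure_iff]
  intro W hW hzW
  obtain ⟨y, -, hyW, hyU⟩ := hZ.2 W U hW hU ⟨z, hz, hzW⟩ ⟨x, hU' hx, hx⟩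
  exact ⟨y, hyW, hyU⟩

theorem Law.isIrreducible_orbitInVariety {l : Law n m} (h : l.orbit ⊆ nilpotentVariety n m) :
    IsIrreducible l.orbitInVariety := by
  obtain ⟨⟨l₀, hl₀⟩, hirr⟩ := l.isIrreducible_orbit
  refine ⟨⟨⟨l₀, h hl₀⟩, hl₀⟩, ?_⟩
  rintro U W hU hW ⟨a, ha, haU⟩ ⟨b, hb, hbW⟩
  obtain ⟨U, hU', rfl⟩ := isOpen_induced_iff.1 hU
  obtain ⟨W, hW', rfl⟩ := isOpen_induced_iff.1 hW
  obtain ⟨c, hc, hcU, hcW⟩ := hirr U W hU' hW' ⟨a, ha, haU⟩ ⟨b, hb, hbW⟩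
  exact ⟨⟨c, h hc⟩, hc, hcU, hcW⟩

end Irreducible

/-! ### Invariance of the variety under change of basis, and a nilpotency criterion. -/

section OrbitInvariance

variable {n m : ℕ}

theorem Law.IsLeibniz.of_mem_orbit {l l' : Law n m} (hl : l.IsLeibniz) (h : l' ∈ l.orbit) :
    l'.IsLeibniz := by
  obtain ⟨f₀, f₁, h⟩ := h
  have hf : ∀ x y, (f₀.prodCongr f₁) (l'.bracket x y) =
      l.bracket ((f₀.prodCongr f₁) x) ((f₀.prodCongr f₁) y) := fun x y => by
    rw [h, LinearEquiv.apply_symm_apply]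
  have hhom : ∀ (α : ZMod 2) (x : V n m), x ∈ homogeneous n m α →
      (f₀.prodCongr f₁) x ∈ homogeneous n m α := by
    intro α x hx
    fin_cases α
    · exact mem_homogeneous_zero.2 (by simp [mem_homogeneous_zero.1 hx])
    · exact mem_homogeneous_one.2 (by simp [mem_homogeneous_one.1 hx])
  intro α β x y z hy hz
  apply (f₀.prodCongr f₁).injective
  rw [map_sub, map_smul]
  simp only [hf]
  exact hl α β _ _ _ (hhom α y hy) (hhom β z hz)

theorem Law.IsNilpotent.of_mem_orbit {l l' : Law n m} (hl : l.IsNilpotent) (h : l' ∈ l.orbit) :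
    l'.IsNilpotent := by
  obtain ⟨f₀, f₁, h⟩ := h
  have hle : ∀ k, l'.centralSeries k ≤
      (l.centralSeries k).comap (f₀.prodCongr f₁ : V n m →ₗ[ℂ] V n m) := by
    intro k
    induction k with
    | zero => exact fun _ _ => Submodule.mem_top
    | succ k ih =>
      refine Submodule.map₂_le.2 fun x hx y _ => ?_
      rw [Submodule.mem_comap, h, LinearEquiv.coe_coe, LinearEquiv.apply_symm_apply]
      exact Submodule.apply_mem_map₂ _ (ih hx) Submodule.mem_top
  obtain ⟨k, hk⟩ := hl
  refine ⟨k, (Submodule.eq_bot_iff _).2 fun x hx => ?_⟩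
  have := hle k hx
  rw [hk] at this
  simpa only [Submodule.mem_comap, Submodule.mem_bot, LinearEquiv.coe_coe,
    LinearEquiv.map_eq_zero_iff] using this

theorem Law.orbit_subset_nilpotentVariety {l : Law n m} (hl : l ∈ nilpotentVariety n m) :
    l.orbit ⊆ nilpotentVariety n m :=
  fun _ h => ⟨hl.1.of_mem_orbit h, hl.2.of_mem_orbit h⟩

/-- A law for which right multiplication strictly raises the index of basis vectors is
nilpotent. -/
theorem Law.isNilpotent_of_index_lt (l : Law n m)
    (hxx : ∀ i j k, l (.xx i j k) ≠ 0 → (i : ℕ) < k) (hxy : ∀ i j k, l (.xy i j k) ≠ 0 → (i : ℕ) < k)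
    (hyx : ∀ i j k, l (.yx i j k) ≠ 0 → (i : ℕ) < k) (hyy : ∀ i j k, l (.yy i j k) ≠ 0 → (i : ℕ) < k) :
    l.IsNilpotent := by
  -- Even and odd indices are compared as natural numbers: after `d` steps every coordinate of index
  -- below `d`, of either parity, has vanished.
  have key : ∀ d : ℕ, ∀ x ∈ l.centralSeries d,
      (∀ i : Fin n, (i : ℕ) < d → x.1 i = 0) ∧ ∀ i : Fin m, (i : ℕ) < d → x.2 i = 0 := by
    intro d
    induction d with
    | zero => exact fun x _ => ⟨fun _ h => absurd h (Nat.not_lt_zero _),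
        fun _ h => absurd h (Nat.not_lt_zero _)⟩
    | succ d ih =>
      let S : Submodule ℂ (V n m) :=
        { carrier := {x | (∀ i : Fin n, (i : ℕ) < d + 1 → x.1 i = 0) ∧
            ∀ i : Fin m, (i : ℕ) < d + 1 → x.2 i = 0}
          add_mem' := fun {x y} hx hy => ⟨fun i hi => by simp [hx.1 i hi, hy.1 i hi],
            fun i hi => by simp [hx.2 i hi, hy.2 i hi]⟩
          zero_mem' := ⟨fun _ _ => rfl, fun _ _ => rfl⟩
          smul_mem' := fun c x hx => ⟨fun i hi => by simp [hx.1 i hi],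
            fun i hi => by simp [hx.2 i hi]⟩ }
      have hsum : ∀ {p q : ℕ} (f : Fin p → ℂ) (g : Fin q → ℂ) (c : Fin p → Fin q → ℂ) (k : ℕ),
          (∀ i : Fin p, (i : ℕ) < d → f i = 0) → (∀ i j, c i j ≠ 0 → (i : ℕ) < k) → k < d + 1 →
          ∑ i, ∑ j, f i * g j * c i j = 0 := by
        intro p q f g c k hf hc hk
        refine Finset.sum_eq_zero fun i _ => Finset.sum_eq_zero fun j _ => ?_
        by_cases h : c i j = 0
        · rw [h, mul_zero]
        · have := hc i j h
          rw [hf i (by omega), zero_mul, zero_mul]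
      have : l.centralSeries (d + 1) ≤ S := by
        refine Submodule.map₂_le.2 fun x hx y _ => ?_
        obtain ⟨h₀, h₁⟩ := ih x hx
        refine ⟨fun k hk => ?_, fun k hk => ?_⟩
        · change _ + _ = (0 : ℂ)
          rw [hsum x.1 y.1 _ k h₀ (fun i j => hxx i j k) hk,
            hsum x.2 y.2 _ k h₁ (fun i j => hyy i j k) hk, add_zero]
        · change _ + _ = (0 : ℂ)
          rw [hsum x.1 y.2 _ k h₀ (fun i j => hxy i j k) hk,
            hsum x.2 y.1 _ k h₁ (fun i j => hyx i j k) hk, add_zero]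
      exact fun x hx => this hx
  refine ⟨n + m, (Submodule.eq_bot_iff _).2 fun x hx => ?_⟩
  obtain ⟨h₀, h₁⟩ := key _ x hx
  exact Prod.ext (funext fun i => h₀ i (by omega)) (funext fun i => h₁ i (by omega))

end OrbitInvariance

/-! ### The two model laws in coordinate-free form, and their membership in the variety. -/

section ModelLaws

/-- The `k`-th basis vector of `V₀`, which is zero for `k > n`. -/
def unitVec (n k : ℕ) : Fin (n + 1) → ℂ := fun i => if (i : ℕ) = k then 1 else 0

theorem unitVec_eq_zero {n k : ℕ} (h : n < k) : unitVec n k = 0 :=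
  funext fun i => if_neg (by omega)

theorem unitVec_apply_zero {n k : ℕ} (h : k ≠ 0) : unitVec n k 0 = 0 :=
  if_neg (by simpa using h.symm)

theorem unitVec_val {n : ℕ} (i : Fin (n + 1)) : unitVec n i = Pi.single i 1 := by
  ext j
  simp [unitVec, Pi.single_apply, Fin.ext_iff]

/-- The nilpotent shift `X_i ↦ X_{i+1}` of `V₀`. -/
def shift (n : ℕ) : (Fin (n + 1) → ℂ) →ₗ[ℂ] (Fin (n + 1) → ℂ) where
  toFun v := ∑ i : Fin (n + 1), v i • unitVec n (i + 1)
  map_add' v w := by simp [add_smul, Finset.sum_add_distrib]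
  map_smul' c v := by simp [Finset.smul_sum, mul_smul]

/-- No bound on `k` is needed, since `unitVec` is zero beyond the last index. -/
theorem shift_unitVec (n k : ℕ) : shift n (unitVec n k) = unitVec n (k + 1) := by
  change ∑ i : Fin (n + 1), unitVec n k i • unitVec n (i + 1) = _
  rcases lt_or_ge n k with h | h
  · rw [unitVec_eq_zero h, unitVec_eq_zero (by omega)]
    simp
  · rw [Finset.sum_eq_single (⟨k, by omega⟩ : Fin (n + 1))]
    · simp [unitVec]
    · intro i _ hi
      rw [unitVec, if_neg (fun h => hi (Fin.ext h)), zero_smul]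
    · simp

theorem shift_apply_zero (n : ℕ) (v : Fin (n + 1) → ℂ) : shift n v 0 = 0 := by
  change (∑ i : Fin (n + 1), v i • unitVec n (i + 1)) 0 = 0
  rw [Finset.sum_apply]
  exact Finset.sum_eq_zero fun i _ => by simp [unitVec]

theorem shift_apply (n : ℕ) (v : Fin (n + 1) → ℂ) (k : Fin (n + 1)) :
    shift n v k = ∑ i : Fin (n + 1), if (k : ℕ) = i + 1 then v i else 0 := by
  change (∑ i : Fin (n + 1), v i • unitVec n (i + 1)) k = _
  simp [unitVec]

theorem sum_shift {n : ℕ} (v w : Fin (n + 1) → ℂ) (k : Fin (n + 1)) :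
    (∑ i, ∑ j, v i * w j * if j = 0 ∧ (k : ℕ) = i + 1 then (1 : ℂ) else 0) =
      w 0 * shift n v k := by
  simp [ite_and, shift_apply, Finset.mul_sum, mul_comm]

theorem mu2_bracket {n : ℕ} (hn : 2 ≤ n) (x y : V (n + 1) 2) :
    (mu2 n).bracket x y =
      (y.1 0 • shift n x.1 + (x.2 0 * y.2 0) • unitVec n (n - 1) + (x.2 1 * y.2 0) • unitVec n n,
        ![0, x.2 0 * y.1 0]) := by
  refine Prod.ext (funext fun k => ?_) (funext fun k => ?_)
  · have h : ((k : ℕ) + 1 = n) = ((k : ℕ) = n - 1) := propext (by omega)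
    refine (congrArg₂ (· + ·) (sum_shift x.1 y.1 k) rfl).trans ?_
    simp [mu2, Fin.sum_univ_two, unitVec, h, add_assoc]
  · fin_cases k <;> simp [Law.bracket_apply, mu2, Fin.sum_univ_two, ite_and]

theorem mu3_bracket {n : ℕ} (hn : 2 ≤ n) (x y : V (n + 1) 2) :
    (mu3 n).bracket x y =
      (y.1 0 • shift n x.1 + (x.2 0 * y.2 0) • unitVec n (n - 1) + (x.2 0 * y.2 1) • unitVec n n,
        ![0, x.2 0 * y.1 0 - x.1 0 * y.2 0]) := by
  refine Prod.ext (funext fun k => ?_) (funext fun k => ?_)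
  · have h : ((k : ℕ) + 1 = n) = ((k : ℕ) = n - 1) := propext (by omega)
    refine (congrArg₂ (· + ·) (sum_shift x.1 y.1 k) rfl).trans ?_
    simp [mu3, Fin.sum_univ_two, unitVec, h, add_assoc]
  · fin_cases k <;> simp [Law.bracket_apply, mu3, Fin.sum_univ_two, ite_and]
    ring

theorem mu2_isNilpotent {n : ℕ} (hn : 2 ≤ n) : (mu2 n).IsNilpotent := by
  refine Law.isNilpotent_of_index_lt _ ?_ ?_ ?_ ?_ <;> intro i j k h <;>
    simp only [mu2, ne_eq, ite_eq_right_iff, not_forall, not_true_eq_false] at h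
  · obtain ⟨⟨-, h⟩, -⟩ := h
    omega
  · obtain ⟨⟨rfl, -, rfl⟩, -⟩ := h
    simp
  · obtain ⟨⟨rfl, -, h⟩ | ⟨rfl, -, h⟩, -⟩ := h
    · rw [Fin.val_zero]
      omega
    · rw [Fin.val_one]
      omega

theorem mu3_isNilpotent {n : ℕ} (hn : 2 ≤ n) : (mu3 n).IsNilpotent := by
  refine Law.isNilpotent_of_index_lt _ ?_ ?_ ?_ ?_ <;> intro i j k h <;>
    simp only [mu3, ne_eq, ite_eq_right_iff, not_forall] at h
  · obtain ⟨⟨-, h⟩, -⟩ := h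
    omega
  · obtain ⟨⟨rfl, -, rfl⟩, -⟩ := h
    simp
  · obtain ⟨⟨rfl, -, rfl⟩, -⟩ := h
    simp
  · obtain ⟨⟨rfl, -, h⟩ | ⟨rfl, -, h⟩, -⟩ := h <;> rw [Fin.val_zero] <;> omega

/-- The sign depends only on the parities of `y` and `z`, and it is `+` exactly when both are odd.
-/
theorem Law.isLeibniz_iff {n m : ℕ} {l : Law n m} :
    l.IsLeibniz ↔
      (∀ x y z, y.2 = 0 → z.2 = 0 →
        l.bracket x (l.bracket y z) = l.bracket (l.bracket x y) z - l.bracket (l.bracket x z) y) ∧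
      (∀ x y z, y.2 = 0 → z.1 = 0 →
        l.bracket x (l.bracket y z) = l.bracket (l.bracket x y) z - l.bracket (l.bracket x z) y) ∧
      (∀ x y z, y.1 = 0 → z.2 = 0 →
        l.bracket x (l.bracket y z) = l.bracket (l.bracket x y) z - l.bracket (l.bracket x z) y) ∧
      ∀ x y z, y.1 = 0 → z.1 = 0 →
        l.bracket x (l.bracket y z) =
          l.bracket (l.bracket x y) z + l.bracket (l.bracket x z) y := by
  have h0 : (0 : ZMod 2).val = 0 := rfl
  have h1 : (1 : ZMod 2).val = 1 := rfl
  constructor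
  · intro h
    refine ⟨fun x y z hy hz => ?_, fun x y z hy hz => ?_, fun x y z hy hz => ?_,
      fun x y z hy hz => ?_⟩
    · simpa [h0] using h 0 0 x y z (mem_homogeneous_zero.2 hy) (mem_homogeneous_zero.2 hz)
    · simpa [h0] using h 0 1 x y z (mem_homogeneous_zero.2 hy) (mem_homogeneous_one.2 hz)
    · simpa [h0] using h 1 0 x y z (mem_homogeneous_one.2 hy) (mem_homogeneous_zero.2 hz)
    · simpa [h1] using h 1 1 x y z (mem_homogeneous_one.2 hy) (mem_homogeneous_one.2 hz)
  · rintro ⟨h₀₀, h₀₁, h₁₀, h₁₁⟩ α β x y z hy hz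
    have hα : ∀ α : ZMod 2, α = 0 ∨ α = 1 := by decide
    obtain rfl | rfl := hα α <;> obtain rfl | rfl := hα β <;>
      simp only [mem_homogeneous_zero, mem_homogeneous_one] at hy hz
    · simpa [h0] using h₀₀ x y z hy hz
    · simpa [h0] using h₀₁ x y z hy hz
    · simpa [h0] using h₁₀ x y z hy hz
    · simpa [h1] using h₁₁ x y z hy hz

theorem mu2_isLeibniz {n : ℕ} (hn : 2 ≤ n) : (mu2 n).IsLeibniz := by
  have h1 : shift n (unitVec n (n - 1)) = unitVec n n := by
    rw [shift_unitVec, Nat.sub_add_cancel (by omega)]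
  have h2 : shift n (unitVec n n) = 0 := by rw [shift_unitVec, unitVec_eq_zero (by omega)]
  have h3 : unitVec n (n - 1) 0 = 0 := unitVec_apply_zero (by omega)
  have h4 : unitVec n n 0 = 0 := unitVec_apply_zero (by omega)
  refine Law.isLeibniz_iff.2 ⟨?_, ?_, ?_, ?_⟩ <;> intro x y z hy hz <;>
    simp [mu2_bracket hn, hy, hz, h1, h2, h3, h4, shift_apply_zero] <;> module

theorem mu3_isLeibniz {n : ℕ} (hn : 2 ≤ n) : (mu3 n).IsLeibniz := by
  have h1 : shift n (unitVec n (n - 1)) = unitVec n n := by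
    rw [shift_unitVec, Nat.sub_add_cancel (by omega)]
  have h2 : shift n (unitVec n n) = 0 := by rw [shift_unitVec, unitVec_eq_zero (by omega)]
  have h3 : unitVec n (n - 1) 0 = 0 := unitVec_apply_zero (by omega)
  have h4 : unitVec n n 0 = 0 := unitVec_apply_zero (by omega)
  refine Law.isLeibniz_iff.2 ⟨?_, ?_, ?_, ?_⟩ <;> intro x y z hy hz <;>
    simp [mu3_bracket hn, hy, hz, h1, h2, h3, h4, shift_apply_zero] <;> module

end ModelLaws

/-! ### Bases adapted to a right multiplication. -/

section Frame

theorem shift_apply_of_eq {n : ℕ} (v : Fin (n + 1) → ℂ) {i k : Fin (n + 1)} (h : (k : ℕ) = i + 1) :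
    shift n v k = v i := by
  rw [shift_apply, Finset.sum_eq_single i]
  · rw [if_pos h]
  · intro j _ hj
    exact if_neg fun h' => hj (Fin.ext (by omega))
  · simp

theorem eq_sum_unitVec {n : ℕ} (v : Fin (n + 1) → ℂ) : v = ∑ i, v i • unitVec n i := by
  simp_rw [unitVec_val]
  exact pi_eq_sum_univ' v

/-- The coordinate of index `i` reappears in the double shift at index `i + 2`, so only the last two
coordinates can survive. -/
theorem eq_of_shift_shift_eq_zero {n : ℕ} (hn : 1 ≤ n) {v : Fin (n + 1) → ℂ}
    (h : shift n (shift n v) = 0) :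
    ∃ s t : ℂ, v = s • unitVec n (n - 1) + t • unitVec n n := by
  refine ⟨v ⟨n - 1, by omega⟩, v ⟨n, by omega⟩, funext fun i => ?_⟩
  simp only [Pi.add_apply, Pi.smul_apply, unitVec, smul_eq_mul]
  by_cases h1 : (i : ℕ) = n - 1
  · rw [if_pos h1, if_neg (show ¬ (i : ℕ) = n by omega), mul_one, mul_zero, add_zero]
    exact congrArg v (Fin.ext h1)
  · by_cases h2 : (i : ℕ) = n
    · rw [if_neg h1, if_pos h2, mul_one, mul_zero, zero_add]
      exact congrArg v (Fin.ext h2)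
    · have hi : (i : ℕ) + 2 < n + 1 := by omega
      have := congrFun h ⟨i + 2, hi⟩
      rw [shift_apply_of_eq (i := ⟨i + 1, by omega⟩) _ rfl, shift_apply_of_eq (i := i) _ rfl] at this
      simpa [h1, h2] using this

/-- A nilpotent endomorphism of maximal nilpotency index is a shift in a suitable basis. -/
theorem exists_equiv_pow_apply {d : ℕ} {T : Module.End ℂ (Fin (d + 1) → ℂ)} (hT : IsNilpotent T)
    {v : Fin (d + 1) → ℂ} (hv : (T ^ d) v ≠ 0) :
    ∃ g : (Fin (d + 1) → ℂ) ≃ₗ[ℂ] (Fin (d + 1) → ℂ), ∀ k, g (unitVec d k) = (T ^ k) v := by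
  -- Cayley–Hamilton: a nilpotent endomorphism has characteristic polynomial `X ^ (d + 1)`.
  have hT' : T ^ (d + 1) = 0 := by
    have h := T.aeval_self_charpoly
    rw [IsNilpotent.charpoly_eq_X_pow_finrank hT] at h
    simpa using h
  have hzero : ∀ k, d < k → (T ^ k) v = 0 := fun k hk => by
    rw [← Nat.sub_add_cancel (Nat.succ_le_of_lt hk), pow_add]
    simp [hT']
  let G : Module.End ℂ (Fin (d + 1) → ℂ) := Fintype.linearCombination ℂ fun i => (T ^ (i : ℕ)) v
  have hG : ∀ c, G c = ∑ i : Fin (d + 1), c i • (T ^ (i : ℕ)) v := fun c =>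
    Fintype.linearCombination_apply ..
  have hinj : Function.Injective G := by
    refine (injective_iff_map_eq_zero G).2 fun c hc => ?_
    have key : ∀ (k : ℕ) (i : Fin (d + 1)), (i : ℕ) = k → c i = 0 := by
      intro k
      induction k using Nat.strong_induction_on with
      | _ k ih =>
        intro i hi
        -- The earlier coefficients vanish by induction, and this power of `T` kills the later
        -- terms; what remains is `c i • (T ^ d) v`.
        have h : (T ^ (d - i : ℕ)) (G c) = 0 := by rw [hc, map_zero]
        rw [hG, map_sum, Finset.sum_eq_single i] at h
        · rw [map_smul, ← Module.End.mul_apply, ← pow_add, Nat.sub_add_cancel (by omega)] at h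
          exact (smul_eq_zero.1 h).resolve_right hv
        · intro j _ hj
          rcases lt_or_gt_of_ne (fun h => hj (Fin.ext h) : (j : ℕ) ≠ i) with hlt | hgt
          · rw [ih j (hi ▸ hlt) j rfl, zero_smul, map_zero]
          · rw [map_smul, ← Module.End.mul_apply, ← pow_add, hzero _ (by omega), smul_zero]
        · simp
    exact funext fun i => key i i rfl
  refine ⟨LinearEquiv.ofInjectiveEndo G hinj, fun k => ?_⟩
  rw [LinearEquiv.coe_ofInjectiveEndo, hG]
  rcases lt_or_ge d k with h | h
  · rw [unitVec_eq_zero h, hzero k h]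
    simp
  · rw [Finset.sum_eq_single (⟨k, by omega⟩ : Fin (d + 1))]
    · simp [unitVec]
    · intro i _ hi
      rw [unitVec, if_neg (fun h => hi (Fin.ext h)), zero_smul]
    · simp

variable {n m : ℕ}

/-- Right multiplication by `a`. -/
noncomputable def Law.rightMul (l : Law n m) (a : V n m) : Module.End ℂ (V n m) :=
  l.bracket.flip a

theorem Law.rightMul_apply (l : Law n m) (a z : V n m) : l.rightMul a z = l.bracket z a :=
  rfl

theorem Law.rightMul_add (l : Law n m) (a b : V n m) :
    l.rightMul (a + b) = l.rightMul a + l.rightMul b :=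
  map_add l.bracket.flip a b

theorem Law.rightMul_smul (l : Law n m) (c : ℂ) (a : V n m) :
    l.rightMul (c • a) = c • l.rightMul a :=
  map_smul l.bracket.flip c a

theorem Law.rightMul_zero (l : Law n m) : l.rightMul 0 = 0 :=
  map_zero l.bracket.flip

theorem Law.rightMul_fst_of_even (l : Law n m) {a : V n m} (ha : a.2 = 0) (z : V n m) :
    (l.rightMul a z).1 = (l.rightMul a (z.1, 0)).1 := by
  simp [Law.rightMul_apply, Law.bracket_apply, ha]

theorem Law.rightMul_snd_of_even (l : Law n m) {a : V n m} (ha : a.2 = 0) (z : V n m) :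
    (l.rightMul a z).2 = (l.rightMul a (0, z.2)).2 := by
  simp [Law.rightMul_apply, Law.bracket_apply, ha]

theorem Law.rightMul_snd_of_even_even (l : Law n m) {a b : V n m} (ha : a.2 = 0) (hb : b.2 = 0) :
    (l.rightMul b a).2 = 0 := by
  ext; simp [Law.rightMul_apply, Law.bracket_apply, ha, hb]

theorem Law.rightMul_fst_of_even_odd (l : Law n m) {a b : V n m} (ha : a.2 = 0) (hb : b.1 = 0) :
    (l.rightMul b a).1 = 0 := by
  ext; simp [Law.rightMul_apply, Law.bracket_apply, ha, hb]

theorem Law.rightMul_fst_of_odd_even (l : Law n m) {a b : V n m} (ha : a.1 = 0) (hb : b.2 = 0) :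
    (l.rightMul b a).1 = 0 := by
  ext; simp [Law.rightMul_apply, Law.bracket_apply, ha, hb]

theorem Law.rightMul_snd_of_odd_odd (l : Law n m) {a b : V n m} (ha : a.1 = 0) (hb : b.1 = 0) :
    (l.rightMul b a).2 = 0 := by
  ext; simp [Law.rightMul_apply, Law.bracket_apply, ha, hb]

theorem Law.IsNilpotent.exists_rightMul_pow_eq_zero {l : Law n m} (hl : l.IsNilpotent)
    (a : V n m) : ∃ k, l.rightMul a ^ k = 0 := by
  obtain ⟨k, hk⟩ := hl
  have h : ∀ j z, (l.rightMul a ^ j) z ∈ l.centralSeries j := by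
    intro j z
    induction j with
    | zero => exact Submodule.mem_top
    | succ j ih =>
      rw [pow_succ', Module.End.mul_apply]
      rw [Law.rightMul_apply, Law.centralSeries]
      exact Submodule.apply_mem_map₂ l.bracket ih Submodule.mem_top
  refine ⟨k, LinearMap.ext fun z => ?_⟩
  simpa only [hk, Submodule.mem_bot, LinearMap.zero_apply] using h k z

/-- The restriction of right multiplication by an even element to `V₀`. -/
noncomputable def Law.rightMulEven (l : Law n m) (a : V n m) : Module.End ℂ (Fin n → ℂ) :=
  LinearMap.fst ℂ _ _ ∘ₗ l.rightMul a ∘ₗ LinearMap.inl ℂ _ _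

/-- The restriction of right multiplication by an even element to `V₁`. -/
noncomputable def Law.rightMulOdd (l : Law n m) (a : V n m) : Module.End ℂ (Fin m → ℂ) :=
  LinearMap.snd ℂ _ _ ∘ₗ l.rightMul a ∘ₗ LinearMap.inr ℂ _ _

theorem Law.rightMul_pow_of_even (l : Law n m) {a : V n m} (ha : a.2 = 0) (k : ℕ) (z : V n m) :
    (l.rightMul a ^ k) z = ((l.rightMulEven a ^ k) z.1, (l.rightMulOdd a ^ k) z.2) := by
  induction k with
  | zero => rfl
  | succ k ih =>
    rw [pow_succ', pow_succ', pow_succ', Module.End.mul_apply, ih]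
    exact Prod.ext (l.rightMul_fst_of_even ha _) (l.rightMul_snd_of_even ha _)

theorem Law.IsNilpotent.isNilpotent_rightMulEven {l : Law n m} (hl : l.IsNilpotent) {a : V n m}
    (ha : a.2 = 0) : _root_.IsNilpotent (l.rightMulEven a) := by
  obtain ⟨k, hk⟩ := hl.exists_rightMul_pow_eq_zero a
  refine ⟨k, LinearMap.ext fun z => ?_⟩
  have := l.rightMul_pow_of_even ha k (z, 0)
  rw [hk] at this
  exact (congrArg Prod.fst this).symm

theorem Law.IsNilpotent.isNilpotent_rightMulOdd {l : Law n m} (hl : l.IsNilpotent) {a : V n m}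
    (ha : a.2 = 0) : _root_.IsNilpotent (l.rightMulOdd a) := by
  obtain ⟨k, hk⟩ := hl.exists_rightMul_pow_eq_zero a
  refine ⟨k, LinearMap.ext fun z => ?_⟩
  have := l.rightMul_pow_of_even ha k (0, z)
  rw [hk] at this
  exact (congrArg Prod.snd this).symm

/-- The basis of `V₀` formed by the left-normed powers of an even element. -/
theorem Law.IsNilpotent.exists_even_frame {l : Law (n + 1) m} (hl : l.IsNilpotent)
    {a : V (n + 1) m} (ha : a.2 = 0) (h : (l.rightMul a ^ n) a ≠ 0) :
    ∃ g : (Fin (n + 1) → ℂ) ≃ₗ[ℂ] (Fin (n + 1) → ℂ),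
      ∀ k, ((g (unitVec n k), 0) : V (n + 1) m) = (l.rightMul a ^ k) a := by
  have hpow : ∀ k, (l.rightMul a ^ k) a = ((l.rightMulEven a ^ k) a.1, 0) := fun k => by
    rw [l.rightMul_pow_of_even ha, ha, map_zero]
  obtain ⟨g, hg⟩ := exists_equiv_pow_apply (hl.isNilpotent_rightMulEven ha) (v := a.1)
    (fun h' => h (by rw [hpow, h']; rfl))
  exact ⟨g, fun k => by rw [hg, hpow]⟩

/-- The basis of a two-dimensional `V₁` formed by an odd element and its right multiple. -/
theorem Law.IsNilpotent.exists_odd_frame {l : Law n 2} (hl : l.IsNilpotent)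
    {a y : V n 2} (ha : a.2 = 0) (hy : y.1 = 0) (h : l.rightMul a y ≠ 0) :
    ∃ g : (Fin 2 → ℂ) ≃ₗ[ℂ] (Fin 2 → ℂ),
      (∀ c, ((0, g c) : V n 2) = c 0 • y + c 1 • l.rightMul a y) ∧
        l.rightMul a (l.rightMul a y) = 0 := by
  have hpow : ∀ k, (l.rightMul a ^ k) y = (0, (l.rightMulOdd a ^ k) y.2) := fun k => by
    rw [l.rightMul_pow_of_even ha, hy, map_zero]
  have h1 := hpow 1
  rw [pow_one] at h1
  obtain ⟨g, hg⟩ := exists_equiv_pow_apply (d := 1) (hl.isNilpotent_rightMulOdd ha) (v := y.2)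
    (fun h' => h (by rw [h1, h']; rfl))
  have hg' : ∀ k, ((0, g (unitVec 1 k)) : V n 2) = (l.rightMul a ^ k) y := fun k => by
    rw [hg, hpow]
  refine ⟨g, fun c => ?_, ?_⟩
  · have h0 := hg' 0
    have h1 := hg' 1
    rw [pow_zero, Module.End.one_apply] at h0
    rw [pow_one] at h1
    rw [← h1]
    rw [show c 0 • y = c 0 • ((0, g (unitVec 1 0)) : V n 2) by rw [h0]]
    conv_lhs => rw [eq_sum_unitVec c]
    simp [Fin.sum_univ_two]
  · have h2 := hg' 2
    rw [unitVec_eq_zero (by omega), pow_two, Module.End.mul_apply, map_zero] at h2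
    exact h2.symm

end Frame

/-! ### Consequences of the Leibniz identity for the products of the generators. -/

section Structure

variable {n m : ℕ} {l : Law n m}

theorem Law.IsLeibniz.rightMul_even_even (hl : l.IsLeibniz) {a b : V n m} (ha : a.2 = 0)
    (hb : b.2 = 0) :
    l.rightMul (l.rightMul b a) = l.rightMul b * l.rightMul a - l.rightMul a * l.rightMul b :=
  LinearMap.ext fun x => (Law.isLeibniz_iff.1 hl).1 x a b ha hb

theorem Law.IsLeibniz.rightMul_even_odd (hl : l.IsLeibniz) {a b : V n m} (ha : a.2 = 0)
    (hb : b.1 = 0) :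
    l.rightMul (l.rightMul b a) = l.rightMul b * l.rightMul a - l.rightMul a * l.rightMul b :=
  LinearMap.ext fun x => (Law.isLeibniz_iff.1 hl).2.1 x a b ha hb

theorem Law.IsLeibniz.rightMul_odd_even (hl : l.IsLeibniz) {a b : V n m} (ha : a.1 = 0)
    (hb : b.2 = 0) :
    l.rightMul (l.rightMul b a) = l.rightMul b * l.rightMul a - l.rightMul a * l.rightMul b :=
  LinearMap.ext fun x => (Law.isLeibniz_iff.1 hl).2.2.1 x a b ha hb

theorem Law.IsLeibniz.rightMul_odd_odd (hl : l.IsLeibniz) {a b : V n m} (ha : a.1 = 0)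
    (hb : b.1 = 0) :
    l.rightMul (l.rightMul b a) = l.rightMul b * l.rightMul a + l.rightMul a * l.rightMul b :=
  LinearMap.ext fun x => (Law.isLeibniz_iff.1 hl).2.2.2 x a b ha hb

/-- The products of a Leibniz superalgebra whose even part is spanned by the left-normed powers
of `x` and whose odd part is spanned by `y` and `[y, x]`. -/
structure Law.ProductTable (l : Law n m) (x y : V n m) (b : ℂ) : Prop where
  rightMul_y_x : l.rightMul y x = b • l.rightMul x y
  smul_rightMul : (b + 1) • l.rightMul (l.rightMul x y) = 0
  rightMul_image : ∀ z : V n m, z.2 = 0 → l.rightMul (l.rightMul x z) = 0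
  rightMul_y_image : ∀ z : V n m, z.2 = 0 → l.rightMul y (l.rightMul x z) = 0
  rightMul_yx_even : ∀ z : V n m, z.2 = 0 → l.rightMul (l.rightMul x y) z = 0
  smul_yx_y : b • l.rightMul y (l.rightMul x y) = 0
  add_eq : l.rightMul y (l.rightMul x y) + l.rightMul (l.rightMul x y) y =
    l.rightMul x (l.rightMul y y)
  yx_yx : l.rightMul (l.rightMul x y) (l.rightMul x y) =
    l.rightMul x (l.rightMul y (l.rightMul x y))
  yx_yx' : l.rightMul (l.rightMul x y) (l.rightMul x y) =
    l.rightMul x (l.rightMul (l.rightMul x y) y)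

/-- The Leibniz identity says that `R_{[a,b]}` is the supercommutator of `R_b` and `R_a`. With `D =
R_x`, `r = R_y` and `S = R_{[y,x]}` this gives `S = Dr - rD` and, since `[[y,x],x] = 0`, `DS = SD`.
Comparing `R_{[x,y]}` with `R_{[y,x]}` yields linear relations between `r` and `S`, from which the
table follows. -/
theorem Law.IsLeibniz.exists_productTable (hl : l.IsLeibniz) {x y : V n m} (hx : x.2 = 0)
    (hy : y.1 = 0)
    (hspan₀ : ∀ z : V n m, z.2 = 0 →
      z ∈ Submodule.span ℂ (Set.range fun k : ℕ => (l.rightMul x ^ k) x))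
    (hspan₁ : ∀ z : V n m, z.1 = 0 → ∃ a b : ℂ, z = a • y + b • l.rightMul x y)
    (hyx : l.rightMul x y ≠ 0) (hyxx : l.rightMul x (l.rightMul x y) = 0)
    (hxxx : l.rightMul x (l.rightMul x x) ≠ 0) :
    ∃ b, l.ProductTable x y b := by
  have hpow : ∀ k, ((l.rightMul x ^ k) x).2 = 0 := by
    intro k
    induction k with
    | zero => exact hx
    | succ k ih =>
      rw [pow_succ', Module.End.mul_apply]
      exact l.rightMul_snd_of_even_even ih hx
  have hyx1 : (l.rightMul x y).1 = 0 := l.rightMul_fst_of_odd_even hy hx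
  have hS := hl.rightMul_odd_even hy hx
  have hxy := hl.rightMul_even_odd hx hy
  have hDS := hl.rightMul_odd_even hyx1 hx
  have hxyx := hl.rightMul_even_odd hx hyx1
  have hRu := hl.rightMul_odd_odd hy hy
  have hRxz := fun (z : V n m) (hz : z.2 = 0) => hl.rightMul_even_even (l := l) hz hx
  have hu2 : (l.rightMul y y).2 = 0 := l.rightMul_snd_of_odd_odd hy hy
  obtain ⟨a, b, hab⟩ := hspan₁ (l.rightMul y x) (l.rightMul_fst_of_even_odd hx hy)
  obtain ⟨a', b', hab'⟩ := hspan₁ (l.rightMul (l.rightMul x y) x)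
    (l.rightMul_fst_of_even_odd hx hyx1)
  have hlin : ∀ (c d : ℂ), l.rightMul (c • y + d • l.rightMul x y) =
      c • l.rightMul y + d • l.rightMul (l.rightMul x y) := fun c d => by
    simp only [Law.rightMul_add, Law.rightMul_smul]
  rw [hab, hlin] at hxy
  rw [hab', hlin] at hxyx
  rw [hyxx, l.rightMul_zero] at hDS
  set D := l.rightMul x with hD
  set r := l.rightMul y with hr
  set S := l.rightMul (D y) with hSdef
  have hxy' : a • r + (b + 1) • S = 0 := by
    rw [add_smul, one_smul, ← add_assoc, hxy, hS]
    abel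
  have hxyx' : a' • r + b' • S = 0 := by
    rw [hxyx, ← neg_sub, ← hDS, neg_zero]
  -- Such a relation makes `r` a multiple of `S`; then `S = Dr - rD` is a multiple of `DS - SD = 0`.
  have hzero : ∀ c d : ℂ, c ≠ 0 → c • r + d • S = 0 → r = 0 ∧ S = 0 := by
    intro c d hc h
    have h1 : r = (-(c⁻¹ * d)) • S := by
      have : c⁻¹ • (c • r + d • S) = 0 := by rw [h, smul_zero]
      rw [smul_add, smul_smul, smul_smul, inv_mul_cancel₀ hc, one_smul] at this
      exact (eq_neg_of_add_eq_zero_left this).trans (neg_smul _ _).symm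
    have h2 : S = 0 := by
      rw [hS, h1, mul_smul_comm, smul_mul_assoc]
      exact (smul_sub _ (D * S) (S * D)).symm.trans (by rw [← hDS, smul_zero])
    exact ⟨by rw [h1, h2, smul_zero], h2⟩
  have hcoef : ∀ c d : ℂ, c • y + d • D y = 0 → c = 0 := by
    intro c d h
    have := congrArg D h
    rw [map_add, map_smul, map_smul, hyxx, smul_zero, add_zero, map_zero] at this
    exact (smul_eq_zero.1 this).resolve_right hyx
  have ha : a = 0 := by
    by_contra ha
    have h := (hzero _ _ ha hxy').1
    rw [h, LinearMap.zero_apply] at hab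
    exact ha (hcoef _ _ hab.symm)
  have hSx : S x = 0 := by
    by_cases ha' : a' = 0
    · by_cases hb' : b' = 0
      · rw [hab', ha', hb', zero_smul, zero_smul, add_zero]
      · rw [ha', zero_smul, zero_add] at hxyx'
        rw [(smul_eq_zero.1 hxyx').resolve_left hb', LinearMap.zero_apply]
    · rw [(hzero _ _ ha' hxyx').2, LinearMap.zero_apply]
  rw [ha, zero_smul, zero_add] at hab hxy'
  have hDS' : ∀ z, S (D z) = D (S z) := fun z =>
    (sub_eq_zero.1 (LinearMap.congr_fun hDS z).symm).symm
  have hSz : ∀ z, S z = D (r z) - r (D z) := fun z => LinearMap.congr_fun hS z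
  have hspan : ∀ {W : Type} [AddCommGroup W] [Module ℂ W] (P : V n m →ₗ[ℂ] W),
      (∀ k, P ((D ^ k) x) = 0) → ∀ z : V n m, z.2 = 0 → P z = 0 := by
    intro W _ _ P hP z hz
    have : Submodule.span ℂ (Set.range fun k : ℕ => (D ^ k) x) ≤ LinearMap.ker P := by
      rw [Submodule.span_le]
      rintro _ ⟨k, rfl⟩
      exact hP k
    exact this (hspan₀ z hz)
  have hS0 : ∀ z : V n m, z.2 = 0 → S z = 0 := by
    refine hspan S fun k => ?_
    induction k with
    | zero => exact hSx
    | succ k ih => rw [pow_succ', Module.End.mul_apply, hDS', ih, map_zero]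
  -- Since `S` vanishes on even vectors, `r` commutes with `D` there, and `D (r x) = b • D (D y) =
  -- 0`.
  have hr0 : ∀ z : V n m, z.2 = 0 → r (D z) = 0 := by
    refine hspan (r ∘ₗ D) fun k => ?_
    rw [LinearMap.comp_apply]
    induction k with
    | zero =>
      have := hSz x
      rw [hSx, hab, map_smul, hyxx, smul_zero, zero_sub, eq_comm, neg_eq_zero] at this
      exact this
    | succ k ih =>
      have := hSz ((D ^ (k + 1)) x)
      rw [hS0 _ (hpow _)] at this
      rw [pow_succ', Module.End.mul_apply] at this ⊢
      rw [ih, map_zero, zero_sub, eq_comm, neg_eq_zero] at this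
      exact this
  have hR0 : ∀ z : V n m, z.2 = 0 → l.rightMul (D z) = 0 := by
    refine hspan (l.bracket.flip ∘ₗ D) fun k => ?_
    change l.rightMul (D ((D ^ k) x)) = 0
    induction k with
    | zero =>
      have := hRxz x hx
      rw [← hD, sub_self] at this
      exact this
    | succ k ih =>
      rw [hRxz _ (hpow _), pow_succ', Module.End.mul_apply, ih]
      simp
  have hdecomp : ∀ z : V n m, z.2 = 0 → ∃ (c : ℂ) (z' : V n m), z'.2 = 0 ∧ z = c • x + D z' := by
    intro z hz
    refine Submodule.span_induction (p := fun z _ =>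
      ∃ (c : ℂ) (z' : V n m), z'.2 = 0 ∧ z = c • x + D z') ?_ ?_ ?_ ?_ (hspan₀ z hz)
    · rintro _ ⟨k, rfl⟩
      cases k with
      | zero => exact ⟨1, 0, rfl, by simp⟩
      | succ k => exact ⟨0, _, hpow k, by simp [pow_succ']⟩
    · exact ⟨0, 0, rfl, by simp⟩
    · rintro _ _ _ _ ⟨c, z, hz, rfl⟩ ⟨c', z', hz', rfl⟩
      exact ⟨c + c', z + z', by simp [hz, hz'], by rw [map_add]; module⟩
    · rintro e _ _ ⟨c, z, hz, rfl⟩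
      exact ⟨e * c, e • z, by simp [hz], by rw [map_smul]; module⟩
  -- For even `z = c • x + D z'` the operator `R_z` is `c • D`, and `D (D x) ≠ 0` detects `c`.
  have hann : ∀ z : V n m, z.2 = 0 → l.rightMul z (D x) = 0 → l.rightMul z = 0 := by
    intro z hz h
    obtain ⟨c, z', hz', rfl⟩ := hdecomp z hz
    have h1 : l.rightMul (c • x + D z') = c • D := by
      rw [show l.rightMul (c • x + D z') = c • l.rightMul x + l.rightMul (D z') by
        simp only [Law.rightMul_add, Law.rightMul_smul], hR0 z' hz', add_zero]
    rw [h1, LinearMap.smul_apply] at h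
    rw [h1, (smul_eq_zero.1 h).resolve_right hxxx, zero_smul]
  -- The left side is `R_{[y,y]}`, with `[y,y]` even, and it kills `D x` because `r (D x) = 0`.
  -- Applied to `x`, the vanishing of `r²` gives `b • r (D y) = 0`.
  have hRu0 : r * r + r * r = 0 := by
    rw [← hRu]
    refine hann _ hu2 ?_
    rw [hRu, LinearMap.add_apply, Module.End.mul_apply, hr0 x hx, map_zero, add_zero]
  refine ⟨b, hab, hxy', hR0, hr0, hS0, ?_, ?_, ?_, hDS' y⟩
  · have h := LinearMap.congr_fun hRu0 x
    rw [LinearMap.add_apply, Module.End.mul_apply, hab, map_smul, LinearMap.zero_apply,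
      ← two_smul ℂ] at h
    exact (smul_eq_zero.1 h).resolve_left two_ne_zero
  · rw [hSz]
    abel
  · rw [hSz, hyxx, map_zero, sub_zero]

end Structure

/-! ### Recognizing the two model laws from non-vanishing products. -/

section Recognition

variable {n m : ℕ}

theorem Law.mem_orbit_of_frame {l μ : Law n m} (g₀ : (Fin n → ℂ) ≃ₗ[ℂ] (Fin n → ℂ))
    (g₁ : (Fin m → ℂ) ≃ₗ[ℂ] (Fin m → ℂ))
    (h : ∀ p q : V n m, l.bracket (g₀ p.1, g₁ p.2) (g₀ q.1, g₁ q.2) =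
      (g₀ (μ.bracket p q).1, g₁ (μ.bracket p q).2)) : l ∈ μ.orbit := by
  refine ⟨g₀.symm, g₁.symm, fun x y => ?_⟩
  have := h (g₀.symm x.1, g₁.symm x.2) (g₀.symm y.1, g₁.symm y.2)
  simp only [LinearEquiv.apply_symm_apply] at this
  exact this

theorem Law.rightMul_even_frame {l : Law (n + 1) m} {x : V (n + 1) m}
    {g : (Fin (n + 1) → ℂ) ≃ₗ[ℂ] (Fin (n + 1) → ℂ)}
    (hg : ∀ k, ((g (unitVec n k), 0) : V (n + 1) m) = (l.rightMul x ^ k) x)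
    (v : Fin (n + 1) → ℂ) :
    l.rightMul x (g v, 0) = (g (shift n v), 0) := by
  have h : l.rightMul x ∘ₗ LinearMap.inl ℂ _ _ ∘ₗ (g : (Fin (n + 1) → ℂ) →ₗ[ℂ] _) =
      LinearMap.inl ℂ _ _ ∘ₗ (g : (Fin (n + 1) → ℂ) →ₗ[ℂ] _) ∘ₗ shift n := by
    refine LinearMap.pi_ext' fun i => LinearMap.ext_ring ?_
    simp only [LinearMap.comp_apply, LinearMap.coe_single, ← unitVec_val, shift_unitVec,
      LinearEquiv.coe_coe, LinearMap.inl_apply, hg, pow_succ', Module.End.mul_apply]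
  exact LinearMap.congr_fun h v

theorem even_eq_sum_frame {l : Law (n + 1) m} {x : V (n + 1) m}
    {g : (Fin (n + 1) → ℂ) ≃ₗ[ℂ] (Fin (n + 1) → ℂ)}
    (hg : ∀ k, ((g (unitVec n k), 0) : V (n + 1) m) = (l.rightMul x ^ k) x)
    (v : Fin (n + 1) → ℂ) :
    ((g v, 0) : V (n + 1) m) = ∑ i : Fin (n + 1), v i • (l.rightMul x ^ (i : ℕ)) x := by
  have : (LinearMap.inl ℂ (Fin (n + 1) → ℂ) (Fin m → ℂ)) (g v) = _ :=
    congrArg (fun v => LinearMap.inl ℂ (Fin (n + 1) → ℂ) (Fin m → ℂ) (g v)) (eq_sum_unitVec v)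
  simpa only [map_sum, map_smul, LinearMap.inl_apply, hg] using this

theorem exists_productTable {l : Law (n + 1) 2} (hn : 2 ≤ n)
    (hl : l ∈ nilpotentVariety (n + 1) 2) {x y : V (n + 1) 2} (hx : x.2 = 0) (hy : y.1 = 0)
    (hxn : (l.rightMul x ^ n) x ≠ 0) (hyx : l.rightMul x y ≠ 0) :
    ∃ b, l.ProductTable x y b := by
  obtain ⟨g₀, hg₀⟩ := hl.2.exists_even_frame hx hxn
  obtain ⟨g₁, hg₁, hyxx⟩ := hl.2.exists_odd_frame hx hy hyx
  refine hl.1.exists_productTable hx hy (fun z hz => ?_) (fun z hz => ?_) hyx hyxx fun h => hxn ?_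
  · have : z = (g₀ (g₀.symm z.1), 0) := Prod.ext (g₀.apply_symm_apply _).symm hz
    rw [this, even_eq_sum_frame hg₀]
    exact Submodule.sum_mem _ fun i _ => Submodule.smul_mem _ _ (Submodule.subset_span ⟨i, rfl⟩)
  · refine ⟨_, _, Eq.trans ?_ (hg₁ (g₁.symm z.2))⟩
    exact Prod.ext hz (g₁.apply_symm_apply _).symm
  · obtain ⟨k, rfl⟩ := Nat.exists_eq_add_of_le' hn
    rw [pow_add, pow_two, Module.End.mul_apply, Module.End.mul_apply, h, map_zero]

theorem Law.ProductTable.bracket_frame {l : Law (n + 1) 2} {x y : V (n + 1) 2} {b : ℂ}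
    (h : l.ProductTable x y b)
    {g₀ : (Fin (n + 1) → ℂ) ≃ₗ[ℂ] (Fin (n + 1) → ℂ)}
    (hg₀ : ∀ k, ((g₀ (unitVec n k), 0) : V (n + 1) 2) = (l.rightMul x ^ k) x)
    {g₁ : (Fin 2 → ℂ) ≃ₗ[ℂ] (Fin 2 → ℂ)}
    (hg₁ : ∀ c, ((0, g₁ c) : V (n + 1) 2) = c 0 • y + c 1 • l.rightMul x y)
    (hyxx : l.rightMul x (l.rightMul x y) = 0) (p q : V (n + 1) 2) :
    l.bracket (g₀ p.1, g₁ p.2) (g₀ q.1, g₁ q.2) =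
      q.1 0 • ((g₀ (shift n p.1), 0) + p.2 0 • l.rightMul x y) +
      q.2 0 • (p.1 0 • b • l.rightMul x y + p.2 0 • l.rightMul y y +
        p.2 1 • l.rightMul y (l.rightMul x y)) +
      q.2 1 • (p.2 0 • l.rightMul (l.rightMul x y) y +
        p.2 1 • l.rightMul (l.rightMul x y) (l.rightMul x y)) := by
  have hsplit : ∀ p : V (n + 1) 2, ((g₀ p.1, g₁ p.2) : V (n + 1) 2) =
      (g₀ p.1, 0) + (p.2 0 • y + p.2 1 • l.rightMul x y) := fun p => by
    rw [← hg₁]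
    simp
  have heven : ∀ k, ((l.rightMul x ^ k) x).2 = 0 := fun k => by rw [← hg₀]
  -- Right multiplication by an even vector only sees its coefficient along `x`, because `R_{[z,x]}
  -- = 0` for even `z`.
  have hx : ∀ v : Fin (n + 1) → ℂ, l.rightMul (g₀ v, 0) = v 0 • l.rightMul x := fun v => by
    have hsum : l.rightMul (g₀ v, 0) =
        ∑ i : Fin (n + 1), v i • l.rightMul ((l.rightMul x ^ (i : ℕ)) x) := by
      rw [even_eq_sum_frame hg₀]
      exact (map_sum l.bracket.flip _ _).trans
        (Finset.sum_congr rfl fun i _ => map_smul l.bracket.flip _ _)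
    rw [hsum, Fin.sum_univ_succ, Finset.sum_eq_zero fun i _ => ?_, add_zero]
    · simp
    · rw [Fin.val_succ, pow_succ', Module.End.mul_apply, h.rightMul_image _ (heven _), smul_zero]
  have hy : ∀ v : Fin (n + 1) → ℂ, l.rightMul y (g₀ v, 0) = v 0 • b • l.rightMul x y := fun v => by
    rw [even_eq_sum_frame hg₀, map_sum, Fin.sum_univ_succ, Finset.sum_eq_zero fun i _ => ?_,
      add_zero]
    · simp [h.rightMul_y_x]
    · rw [Fin.val_succ, map_smul, pow_succ', Module.End.mul_apply,
        h.rightMul_y_image _ (heven _), smul_zero]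
  rw [← Law.rightMul_apply, hsplit p, hsplit q, Law.rightMul_add, Law.rightMul_add,
    Law.rightMul_smul, Law.rightMul_smul, hx]
  simp only [LinearMap.add_apply, LinearMap.smul_apply, map_add, map_smul, hy,
    Law.rightMul_even_frame hg₀, h.rightMul_yx_even (g₀ p.1, 0) rfl, hyxx, smul_zero, add_zero,
    zero_add, add_assoc]
  module

theorem Law.ProductTable.of_y_yx_ne_zero {l : Law n m} {x y : V n m} {b : ℂ}
    (h : l.ProductTable x y b) (hv : l.rightMul y (l.rightMul x y) ≠ 0) :
    b = 0 ∧ l.rightMul (l.rightMul x y) = 0 ∧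
      l.rightMul y (l.rightMul x y) = l.rightMul x (l.rightMul y y) ∧
      l.rightMul x (l.rightMul x (l.rightMul y y)) = 0 := by
  have hb : b = 0 := (smul_eq_zero.1 h.smul_yx_y).resolve_right hv
  have hS : l.rightMul (l.rightMul x y) = 0 := by simpa [hb] using h.smul_rightMul
  have hu : l.rightMul y (l.rightMul x y) = l.rightMul x (l.rightMul y y) := by
    simpa [hS] using h.add_eq
  refine ⟨hb, hS, hu, ?_⟩
  rw [← hu, ← h.yx_yx, hS, LinearMap.zero_apply]

theorem Law.ProductTable.of_yx_y_ne_zero {l : Law n m} {x y : V n m} {b : ℂ}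
    (h : l.ProductTable x y b) (hw : l.rightMul (l.rightMul x y) y ≠ 0) :
    b = -1 ∧ l.rightMul y (l.rightMul x y) = 0 ∧
      l.rightMul (l.rightMul x y) (l.rightMul x y) = 0 ∧
      l.rightMul (l.rightMul x y) y = l.rightMul x (l.rightMul y y) ∧
      l.rightMul x (l.rightMul x (l.rightMul y y)) = 0 := by
  have hb : b = -1 := by
    have := LinearMap.congr_fun h.smul_rightMul y
    rw [LinearMap.smul_apply, LinearMap.zero_apply] at this
    exact eq_neg_of_add_eq_zero_left ((smul_eq_zero.1 this).resolve_right hw)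
  have hv : l.rightMul y (l.rightMul x y) = 0 := by simpa [hb] using h.smul_yx_y
  have hS : l.rightMul (l.rightMul x y) (l.rightMul x y) = 0 := by rw [h.yx_yx, hv, map_zero]
  have hu : l.rightMul (l.rightMul x y) y = l.rightMul x (l.rightMul y y) := by
    simpa [hv] using h.add_eq
  refine ⟨hb, hv, hS, hu, ?_⟩
  rw [← hu, ← h.yx_yx', hS]

/-- The odd generator can be normalized so that its square is the next to last basis vector. -/
theorem Law.ProductTable.exists_normalized {l : Law (n + 1) 2} (hn : 2 ≤ n)
    {x y : V (n + 1) 2} {b : ℂ} (h : l.ProductTable x y b) (hy : y.1 = 0)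
    {g₀ : (Fin (n + 1) → ℂ) ≃ₗ[ℂ] (Fin (n + 1) → ℂ)}
    (hg₀ : ∀ k, ((g₀ (unitVec n k), 0) : V (n + 1) 2) = (l.rightMul x ^ k) x)
    (hS : l.rightMul (l.rightMul x y) (l.rightMul x y) = 0)
    (hu : l.rightMul x (l.rightMul y y) ≠ 0)
    (huu : l.rightMul x (l.rightMul x (l.rightMul y y)) = 0) :
    ∃ β γ : ℂ, β ≠ 0 ∧ l.rightMul (β • y + γ • l.rightMul x y) (β • y + γ • l.rightMul x y) =
      (g₀ (unitVec n (n - 1)), 0) := by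
  obtain ⟨c, hc⟩ : ∃ c, l.rightMul y y = (g₀ c, 0) :=
    ⟨g₀.symm (l.rightMul y y).1,
      Prod.ext (g₀.apply_symm_apply _).symm (l.rightMul_snd_of_odd_odd hy hy)⟩
  have hcc : shift n (shift n c) = 0 := by
    rw [hc, Law.rightMul_even_frame hg₀, Law.rightMul_even_frame hg₀] at huu
    exact (LinearEquiv.map_eq_zero_iff g₀).1 (congrArg Prod.fst huu)
  obtain ⟨s, t, rfl⟩ := eq_of_shift_shift_eq_zero (by omega) hcc
  have hDu : l.rightMul x (l.rightMul y y) = s • (g₀ (unitVec n n), 0) := by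
    rw [hc, Law.rightMul_even_frame hg₀, map_add, map_smul, map_smul, shift_unitVec, shift_unitVec,
      Nat.sub_add_cancel (by omega), unitVec_eq_zero (Nat.lt_succ_self n)]
    simp
  have hs : s ≠ 0 := by
    rintro rfl
    exact hu (by rw [hDu, zero_smul])
  obtain ⟨β, hβ⟩ := IsAlgClosed.exists_pow_nat_eq s⁻¹ (n := 2) (by norm_num)
  have hβ0 : β ≠ 0 := by
    rintro rfl
    exact inv_ne_zero hs (by rw [← hβ]; ring)
  -- Here `[y,y] = s X_{n-1} + t X_n` and `[[y,y],x] = s X_n`. The square of `βy + γ[y,x]` is `β² s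
  -- X_{n-1} + (β² t + βγ s) X_n`, so `β² = s⁻¹` and this `γ` normalize it.
  refine ⟨β, -(β * t / s), hβ0, ?_⟩
  generalize hγ : -(β * t / s) = γ
  have h1 : β ^ 2 * s = 1 := by rw [hβ, inv_mul_cancel₀ hs]
  have h2 : β ^ 2 * t + β * γ * s = 0 := by
    rw [← hγ]
    field_simp
    ring
  have hexp : l.rightMul (β • y + γ • l.rightMul x y) (β • y + γ • l.rightMul x y) =
      β ^ 2 • l.rightMul y y + (β * γ) • (l.rightMul y (l.rightMul x y) +
        l.rightMul (l.rightMul x y) y) +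
      γ ^ 2 • l.rightMul (l.rightMul x y) (l.rightMul x y) := by
    simp only [Law.rightMul_add, Law.rightMul_smul, LinearMap.add_apply, LinearMap.smul_apply,
      map_add, map_smul]
    module
  have hc' : l.rightMul y y = s • (g₀ (unitVec n (n - 1)), 0) + t • (g₀ (unitVec n n), 0) := by
    rw [hc]
    simp
  rw [hexp, h.add_eq, hS, hDu, hc']
  calc _ = (β ^ 2 * s) • ((g₀ (unitVec n (n - 1)), 0) : V (n + 1) 2) +
        (β ^ 2 * t + β * γ * s) • (g₀ (unitVec n n), 0) := by module
    _ = _ := by rw [h1, h2, one_smul, zero_smul, add_zero]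

/-- The case `b = 0`: every right multiplication by `[y,x]` vanishes, and `[[y,x],y] = [[y,y],x]`
becomes `X_n` after normalization. -/
theorem mem_orbit_mu2 {l : Law (n + 1) 2} (hn : 2 ≤ n)
    (hl : l ∈ nilpotentVariety (n + 1) 2) {x y : V (n + 1) 2} (hx : x.2 = 0) (hy : y.1 = 0)
    (hxn : (l.rightMul x ^ n) x ≠ 0) (hv : l.rightMul y (l.rightMul x y) ≠ 0) :
    l ∈ (mu2 n).orbit := by
  have hyx : l.rightMul x y ≠ 0 := fun h => hv (by rw [h, map_zero])
  have hyx1 : (l.rightMul x y).1 = 0 := l.rightMul_fst_of_odd_even hy hx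
  obtain ⟨g₀, hg₀⟩ := hl.2.exists_even_frame hx hxn
  obtain ⟨-, -, hyxx⟩ := hl.2.exists_odd_frame hx hy hyx
  obtain ⟨b, hT⟩ := exists_productTable hn hl hx hy hxn hyx
  obtain ⟨-, hS, hu, huu⟩ := hT.of_y_yx_ne_zero hv
  obtain ⟨β, γ, hβ, hsq⟩ := hT.exists_normalized hn hy hg₀ (by rw [hS, LinearMap.zero_apply])
    (by rwa [← hu]) huu
  have hyx' : l.rightMul x (β • y + γ • l.rightMul x y) = β • l.rightMul x y := by
    rw [map_add, map_smul, map_smul, hyxx, smul_zero, add_zero]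
  have hv' : l.rightMul (β • y + γ • l.rightMul x y)
      (l.rightMul x (β • y + γ • l.rightMul x y)) ≠ 0 := by
    rw [hyx', Law.rightMul_add, Law.rightMul_smul, Law.rightMul_smul, hS, smul_zero, add_zero,
      LinearMap.smul_apply, map_smul]
    exact smul_ne_zero hβ (smul_ne_zero hβ hv)
  have hy' : (β • y + γ • l.rightMul x y).1 = 0 := by simp [hy, hyx1]
  -- The normalized generator satisfies the same hypotheses as `y`, so its frame and product table
  -- are obtained afresh.
  generalize β • y + γ • l.rightMul x y = y' at hsq hv' hy'
  have hyx' : l.rightMul x y' ≠ 0 := fun h => hv' (by rw [h, map_zero])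
  obtain ⟨g₁, hg₁, hyxx'⟩ := hl.2.exists_odd_frame hx hy' hyx'
  obtain ⟨b', hT'⟩ := exists_productTable hn hl hx hy' hxn hyx'
  obtain ⟨rfl, hS', hu', -⟩ := hT'.of_y_yx_ne_zero hv'
  have hDu : l.rightMul x (l.rightMul y' y') = (g₀ (unitVec n n), 0) := by
    rw [hsq, Law.rightMul_even_frame hg₀, shift_unitVec, Nat.sub_add_cancel (by omega)]
  refine Law.mem_orbit_of_frame g₀ g₁ fun p q => ?_
  rw [hT'.bracket_frame hg₀ hg₁ hyxx', hS', hu', hDu, hsq, mu2_bracket hn]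
  have hodd : ∀ c : ℂ, ((0, g₁ ![0, c]) : V (n + 1) 2) = c • l.rightMul x y' := fun c => by
    simp [hg₁]
  have hsplit : ∀ (v : Fin (n + 1) → ℂ) (w : Fin 2 → ℂ),
      ((g₀ v, g₁ w) : V (n + 1) 2) = (g₀ v, 0) + (0, g₁ w) := fun v w => by simp
  rw [hsplit, hodd]
  have hev : ∀ (a b c : ℂ) (u v w : Fin (n + 1) → ℂ), ((g₀ (a • u + b • v + c • w), 0) : V (n + 1) 2)
      = a • (g₀ u, 0) + b • (g₀ v, 0) + c • (g₀ w, 0) := fun a b c u v w => by simp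
  rw [hev]
  simp only [LinearMap.zero_apply]
  module

/-- The case `b = -1`: now `[[y,x],y] = 0`, and `[y,[y,x]] = [[y,y],x]` becomes `X_n` after
normalization. -/
theorem mem_orbit_mu3 {l : Law (n + 1) 2} (hn : 2 ≤ n)
    (hl : l ∈ nilpotentVariety (n + 1) 2) {x y : V (n + 1) 2} (hx : x.2 = 0) (hy : y.1 = 0)
    (hxn : (l.rightMul x ^ n) x ≠ 0) (hw : l.rightMul (l.rightMul x y) y ≠ 0) :
    l ∈ (mu3 n).orbit := by
  have hne : ∀ y, l.rightMul (l.rightMul x y) y ≠ 0 → l.rightMul x y ≠ 0 := fun y hw h =>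
    hw (by rw [h, Law.rightMul_zero, LinearMap.zero_apply])
  have hyx := hne y hw
  have hyx1 : (l.rightMul x y).1 = 0 := l.rightMul_fst_of_odd_even hy hx
  obtain ⟨g₀, hg₀⟩ := hl.2.exists_even_frame hx hxn
  obtain ⟨-, -, hyxx⟩ := hl.2.exists_odd_frame hx hy hyx
  obtain ⟨b, hT⟩ := exists_productTable hn hl hx hy hxn hyx
  obtain ⟨-, -, hS, hu, huu⟩ := hT.of_yx_y_ne_zero hw
  obtain ⟨β, γ, hβ, hsq⟩ := hT.exists_normalized hn hy hg₀ hS (by rwa [← hu]) huu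
  have hyx' : l.rightMul x (β • y + γ • l.rightMul x y) = β • l.rightMul x y := by
    rw [map_add, map_smul, map_smul, hyxx, smul_zero, add_zero]
  have hw' : l.rightMul (l.rightMul x (β • y + γ • l.rightMul x y))
      (β • y + γ • l.rightMul x y) ≠ 0 := by
    rw [hyx', Law.rightMul_smul, LinearMap.smul_apply, map_add, map_smul, map_smul, hS, smul_zero,
      add_zero]
    exact smul_ne_zero hβ (smul_ne_zero hβ hw)
  have hy' : (β • y + γ • l.rightMul x y).1 = 0 := by simp [hy, hyx1]
  generalize β • y + γ • l.rightMul x y = y' at hsq hw' hy'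
  have hyx' := hne y' hw'
  obtain ⟨g₁, hg₁, hyxx'⟩ := hl.2.exists_odd_frame hx hy' hyx'
  obtain ⟨b', hT'⟩ := exists_productTable hn hl hx hy' hxn hyx'
  obtain ⟨rfl, hv', hS', hu', -⟩ := hT'.of_yx_y_ne_zero hw'
  have hDu : l.rightMul x (l.rightMul y' y') = (g₀ (unitVec n n), 0) := by
    rw [hsq, Law.rightMul_even_frame hg₀, shift_unitVec, Nat.sub_add_cancel (by omega)]
  refine Law.mem_orbit_of_frame g₀ g₁ fun p q => ?_
  rw [hT'.bracket_frame hg₀ hg₁ hyxx', hv', hS', hu', hDu, hsq, mu3_bracket hn]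
  have hodd : ∀ c : ℂ, ((0, g₁ ![0, c]) : V (n + 1) 2) = c • l.rightMul x y' := fun c => by
    simp [hg₁]
  have hsplit : ∀ (v : Fin (n + 1) → ℂ) (w : Fin 2 → ℂ),
      ((g₀ v, g₁ w) : V (n + 1) 2) = (g₀ v, 0) + (0, g₁ w) := fun v w => by simp
  rw [hsplit, hodd]
  have hev : ∀ (a b c : ℂ) (u v w : Fin (n + 1) → ℂ), ((g₀ (a • u + b • v + c • w), 0) : V (n + 1) 2)
      = a • (g₀ u, 0) + b • (g₀ v, 0) + c • (g₀ w, 0) := fun a b c u v w => by simp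
  rw [hev]
  module

end Recognition

/-! ### Openness of the two orbits. -/

section Rigidity

variable {n m : ℕ}

theorem IsRegular.rightMul {F G : Law n m → V n m} (hF : IsRegular (polynomialFunctions n m) F)
    (hG : IsRegular (polynomialFunctions n m) G) :
    IsRegular (polynomialFunctions n m) fun l => l.rightMul (F l) (G l) := by
  simp only [Law.rightMul_apply]
  exact IsRegular.bracket coord_mem_polynomialFunctions hG hF

theorem IsRegular.rightMul_pow {x : V n m} (k : ℕ) :
    IsRegular (polynomialFunctions n m) fun l => (l.rightMul x ^ k) x := by
  induction k with
  | zero => exact IsRegular.const _ x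
  | succ k ih =>
    simp only [pow_succ', Module.End.mul_apply]
    exact (IsRegular.const _ x).rightMul ih

/-- The orbit of a law is open in the variety if it is cut out there by the non-vanishing of
polynomial expressions in a pair of vectors, one even and one odd. -/
theorem Law.isOpen_orbitInVariety {μ : Law n m} {F : V n m → Law n m → V n m}
    {G : V n m → V n m → Law n m → V n m}
    (hF : ∀ x, IsRegular (polynomialFunctions n m) (F x))
    (hG : ∀ x y, IsRegular (polynomialFunctions n m) (G x y))
    (hmem : ∀ l ∈ nilpotentVariety n m, ∀ x y : V n m, x.2 = 0 → y.1 = 0 → F x l ≠ 0 →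
      G x y l ≠ 0 → l ∈ μ.orbit)
    (hex : ∀ l ∈ μ.orbit, ∃ x y : V n m, x.2 = 0 ∧ y.1 = 0 ∧ F x l ≠ 0 ∧ G x y l ≠ 0) :
    IsOpen μ.orbitInVariety := by
  refine isOpen_induced_iff.2 ⟨⋃ (x : V n m) (y : V n m) (_ : x.2 = 0) (_ : y.1 = 0),
    {l | F x l ≠ 0} ∩ {l | G x y l ≠ 0}, ?_, ?_⟩
  · exact isOpen_iUnion fun x => isOpen_iUnion fun y => isOpen_iUnion fun _ => isOpen_iUnion fun _ =>
      (hF x).isOpen_ne_zero.inter (hG x y).isOpen_ne_zero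
  · ext ⟨l, hl⟩
    simp only [Set.mem_preimage, Set.mem_iUnion, Set.mem_inter_iff, Set.mem_ofPred_eq]
    constructor
    · rintro ⟨x, y, hx, hy, h1, h2⟩
      exact hmem l hl x y hx hy h1 h2
    · intro h
      obtain ⟨x, y, hx, hy, h1, h2⟩ := hex l h
      exact ⟨x, y, hx, hy, h1, h2⟩

theorem Law.exists_rightMul_of_mem_orbit {l μ : Law n m} (h : l ∈ μ.orbit) :
    ∃ g : V n m ≃ₗ[ℂ] V n m, (∀ x, x.2 = 0 → (g x).2 = 0) ∧ (∀ x, x.1 = 0 → (g x).1 = 0) ∧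
      (∀ x y, l.rightMul (g x) (g y) = g (μ.rightMul x y)) ∧
      ∀ k x y, (l.rightMul (g x) ^ k) (g y) = g ((μ.rightMul x ^ k) y) := by
  obtain ⟨f₀, f₁, h⟩ := h
  have h' : ∀ x y, l.rightMul ((f₀.prodCongr f₁).symm x) ((f₀.prodCongr f₁).symm y) =
      (f₀.prodCongr f₁).symm (μ.rightMul x y) := fun x y => by
    rw [Law.rightMul_apply, h, LinearEquiv.apply_symm_apply, LinearEquiv.apply_symm_apply,
      Law.rightMul_apply]
  refine ⟨(f₀.prodCongr f₁).symm, fun x hx => ?_, fun x hx => ?_, h', fun k x y => ?_⟩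
  · simp [hx]
  · simp [hx]
  · induction k with
    | zero => rfl
    | succ k ih => rw [pow_succ', pow_succ', Module.End.mul_apply, ih, h', Module.End.mul_apply]

theorem rightMul_pow_unitVec {μ : Law (n + 1) 2}
    (h : ∀ v : Fin (n + 1) → ℂ, μ.rightMul (unitVec n 0, 0) (v, 0) = (shift n v, 0)) (k : ℕ) :
    (μ.rightMul (unitVec n 0, 0) ^ k) (unitVec n 0, 0) = (unitVec n k, 0) := by
  induction k with
  | zero => rfl
  | succ k ih => rw [pow_succ', Module.End.mul_apply, ih, h, shift_unitVec]

theorem unitVec_self_ne_zero (n : ℕ) : ((unitVec n n, 0) : V (n + 1) m) ≠ 0 := fun h => by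
  have := congrFun (congrArg Prod.fst h) (Fin.last n)
  simp [unitVec] at this

theorem isOpen_orbitInVariety_mu2 (hn : 2 ≤ n) : IsOpen (mu2 n).orbitInVariety := by
  refine Law.isOpen_orbitInVariety (F := fun x l => (l.rightMul x ^ n) x)
    (G := fun x y l => l.rightMul y (l.rightMul x y)) (fun x => IsRegular.rightMul_pow n)
    (fun x y => (IsRegular.const _ y).rightMul ((IsRegular.const _ x).rightMul (IsRegular.const _ y)))
    (fun l hl x y hx hy => mem_orbit_mu2 hn hl hx hy) fun l hl => ?_
  obtain ⟨g, hg0, hg1, hg, hgpow⟩ := Law.exists_rightMul_of_mem_orbit hl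
  -- The images of `X_0` and `Y_1`: in `mu2` both expressions take the value `X_n` there.
  refine ⟨g (unitVec n 0, 0), g (0, ![1, 0]), hg0 _ rfl, hg1 _ rfl, ?_, ?_⟩
  · rw [hgpow, rightMul_pow_unitVec fun v => ?_]
    · exact (LinearEquiv.map_ne_zero_iff g).2 (unitVec_self_ne_zero n)
    · simp [Law.rightMul_apply, mu2_bracket hn, unitVec]
  · rw [hg, hg]
    refine (LinearEquiv.map_ne_zero_iff g).2 ?_
    simpa [Law.rightMul_apply, mu2_bracket hn, unitVec_apply_zero, unitVec] using
      unitVec_self_ne_zero (m := 2) n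

theorem isOpen_orbitInVariety_mu3 (hn : 2 ≤ n) : IsOpen (mu3 n).orbitInVariety := by
  refine Law.isOpen_orbitInVariety (F := fun x l => (l.rightMul x ^ n) x)
    (G := fun x y l => l.rightMul (l.rightMul x y) y) (fun x => IsRegular.rightMul_pow n)
    (fun x y => ((IsRegular.const _ x).rightMul (IsRegular.const _ y)).rightMul (IsRegular.const _ y))
    (fun l hl x y hx hy => mem_orbit_mu3 hn hl hx hy) fun l hl => ?_
  obtain ⟨g, hg0, hg1, hg, hgpow⟩ := Law.exists_rightMul_of_mem_orbit hl
  -- Again the images of `X_0` and `Y_1`, with `[Y_1, [Y_1, X_0]] = X_n` in `mu3`.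
  refine ⟨g (unitVec n 0, 0), g (0, ![1, 0]), hg0 _ rfl, hg1 _ rfl, ?_, ?_⟩
  · rw [hgpow, rightMul_pow_unitVec fun v => ?_]
    · exact (LinearEquiv.map_ne_zero_iff g).2 (unitVec_self_ne_zero n)
    · simp [Law.rightMul_apply, mu3_bracket hn, unitVec]
  · rw [hg, hg]
    refine (LinearEquiv.map_ne_zero_iff g).2 ?_
    simpa [Law.rightMul_apply, mu3_bracket hn, unitVec_apply_zero, unitVec] using
      unitVec_self_ne_zero (m := 2) n

end Rigidity

end LeibnizSuper

open LeibnizSuper in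
theorem theorem4p8 (n : ℕ) (hn : 2 ≤ n) :
    ((mu2 n).orbit ⊆ nilpotentVariety (n + 1) 2 ∧
      IsOpen (mu2 n).orbitInVariety ∧
      closure (mu2 n).orbitInVariety ∈ irreducibleComponents (nilpotentVariety (n + 1) 2)) ∧
    ((mu3 n).orbit ⊆ nilpotentVariety (n + 1) 2 ∧
      IsOpen (mu3 n).orbitInVariety ∧
      closure (mu3 n).orbitInVariety ∈ irreducibleComponents (nilpotentVariety (n + 1) 2)) := by
  have h2 := Law.orbit_subset_nilpotentVariety ⟨mu2_isLeibniz hn, mu2_isNilpotent hn⟩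
  have h3 := Law.orbit_subset_nilpotentVariety ⟨mu3_isLeibniz hn, mu3_isNilpotent hn⟩
  have o2 := isOpen_orbitInVariety_mu2 hn
  have o3 := isOpen_orbitInVariety_mu3 hn
  exact ⟨⟨h2, o2, o2.closure_mem_irreducibleComponents (Law.isIrreducible_orbitInVariety h2)⟩,
    h3, o3, o3.closure_mem_irreducibleComponents (Law.isIrreducible_orbitInVariety h3)⟩
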